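/- Let $k$ be an algebraically closed field, let $K$ be a finite quiver without oriented cycles, with vertex set $K_0$, and let $A = kK$ be its path algebra. All modules are finite-dimensional left $A$-modules, identified with representations of $K$; in particular $M(x) = e_xM$ for $x \in K_0$, where $e_x$ is the trivial path at $x$, and $P_x = Ae_x$ is the indecomposable projective module at $x$. A module $M$ is *exceptional* if $\operatorname{End}_A(M) = k$ and $\operatorname{Ext}^1_A(M,M) = 0$; it is *sincere* if $M(x) \neq 0$ for all $x \in K_0$. A pair $(N,M)$ is an *exceptional sequence* if $N$ and $M$ are exceptional and $\operatorname{Hom}_A(M,N) = 0 = \operatorname{Ext}^1_A(M,N)$. Let $C(N,M)$ be the smallest full subcategory of the category of $A$-modules that contains $N$ and $M$ and is closed under kernels, cokernels and extensions. Let $\operatorname{add}(M)$ be the class of all direct summands of finite powers of $M$. A *minimal universal extension of objects of $\operatorname{add}(M)$ by $A$* is a short exact sequence $\xi : 0 \to A \to B \to T \to 0$ with $T \in \operatorname{add}(M)$ such that for every $T' \in \operatorname{add}(M)$ the map $\operatorname{Hom}_A(T',T) \to \operatorname{Ext}^1_A(T',A)$, $\varphi \mapsto \xi\varphi$, is surjective,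 and such that every $f \in \operatorname{End}_A(T)$ with $\xi f = \xi$ is an isomorphism. The *Bongartz complement* $\widetilde M$ of an exceptional module $M$ is defined, up to isomorphism, as follows: if $M$ is projective, $M \cong P_s$ with $s \in K_0$, then $\widetilde M = \bigoplus_{t \in K_0,\, t \neq s} P_t$; if $M$ is not projective, then $\widetilde M$ is the middle term $B$ of a minimal universal extension of objects of $\operatorname{add}(M)$ by $A$. **Theorem.** Let $M$ be a sincere exceptional $A$-module. Then a Bongartz complement $\widetilde M$ of $M$ exists, and for every such $\widetilde M$ and every $A$-module $N$ the following are equivalent: 1. $N$ is an indecomposable direct summand of $\widetilde M$. 2. $(N,M)$ is an exceptional sequence and $M$ is not a simple object of $C(N,M)$. -/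

import Mathlib

universe u v w

noncomputable section

open CategoryTheory CategoryTheory.Limits

/-! ## The path algebra of a finite quiver -/

/-- A quiver without oriented cycles: every path from a vertex to itself is trivial. -/
def Quiver.NoOrientedCycles (V : Type v) [Quiver.{w} V] : Prop :=
  ∀ (x : V) (p : Quiver.Path x x), p = Quiver.Path.nil

/-- The set of all paths (with their start and end points, including the trivial paths). -/
abbrev QuiverPaths (V : Type v) [Quiver.{w} V] : Type (max v w) :=
  Σ (x : V) (y : V), Quiver.Path x y

/-- The path algebra `kV`: the vector space with the set of all paths as a basis.
The product `q * p` of two paths is the path "first `p`, then `q`" if `p` ends where `q` starts,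
and `0` otherwise, so that left modules are the same thing as representations of `V`. -/
def PathAlgebra (k : Type u) (V : Type v) [Field k] [Quiver.{w} V] : Type (max u v w) :=
  QuiverPaths V →₀ k

namespace PathAlgebra

variable (k : Type u) {V : Type v} [Field k] [Quiver.{w} V]

instance : AddCommGroup (PathAlgebra k V) :=
  inferInstanceAs (AddCommGroup (QuiverPaths V →₀ k))

instance : Module k (PathAlgebra k V) :=
  inferInstanceAs (Module k (QuiverPaths V →₀ k))

/-- The basis element given by a path. -/
def ofPath (p : QuiverPaths V) : PathAlgebra k V :=
  (Finsupp.single p 1 : QuiverPaths V →₀ k)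

open Classical in
/-- The product `q * p` of two basis elements. -/
def mulPath (q p : QuiverPaths V) : PathAlgebra k V :=
  if h : p.2.1 = q.1 then
    ofPath k ⟨p.1, q.2.1, (p.2.2.cast rfl h).comp q.2.2⟩
  else 0

/-- The bilinear extension of the multiplication of paths. -/
def mulHom : PathAlgebra k V →ₗ[k] PathAlgebra k V →ₗ[k] PathAlgebra k V :=
  Finsupp.linearCombination k fun q : QuiverPaths V =>
    (Finsupp.linearCombination k (mulPath k q) : PathAlgebra k V →ₗ[k] PathAlgebra k V)

instance : Mul (PathAlgebra k V) := ⟨fun a b => mulHom k a b⟩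

/-- The trivial path `e_x` at a vertex `x`. -/
def e (x : V) : PathAlgebra k V := ofPath k ⟨x, x, Quiver.Path.nil⟩

instance [Fintype V] : One (PathAlgebra k V) := ⟨∑ x : V, e k x⟩

variable {k}

lemma mul_def (a b : PathAlgebra k V) : a * b = mulHom k a b := rfl

lemma one_def [Fintype V] : (1 : PathAlgebra k V) = ∑ x : V, e k x := rfl

lemma ofPath_mul_ofPath (q p : QuiverPaths V) : ofPath k q * ofPath k p = mulPath k q p := by
  rw [mul_def, mulHom, ofPath, ofPath]
  erw [Finsupp.linearCombination_single, one_smul, Finsupp.linearCombination_single, one_smul]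

lemma mulPath_comp {x y z : V} (q : Quiver.Path y z) (p : Quiver.Path x y) :
    mulPath k ⟨y, z, q⟩ ⟨x, y, p⟩ = ofPath k ⟨x, z, p.comp q⟩ := by
  simp [mulPath]

lemma mulPath_of_ne (q p : QuiverPaths V) (h : p.2.1 ≠ q.1) : mulPath k q p = 0 := by
  simp [mulPath, h]

lemma induction_on {P : PathAlgebra k V → Prop} (a : PathAlgebra k V) (zero : P 0)
    (add : ∀ a b, P a → P b → P (a + b)) (smul : ∀ (c : k) p, P (c • ofPath k p)) : P a := by
  refine Finsupp.induction_linear (motive := P) a zero add fun p c => ?_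
  have h := smul c p
  have h2 : c • ofPath k p = (Finsupp.single p c : QuiverPaths V →₀ k) := by
    change c • (Finsupp.single p 1 : QuiverPaths V →₀ k) = _
    simp
  rwa [h2] at h

lemma smul_mul' (c : k) (a b : PathAlgebra k V) : (c • a) * b = c • (a * b) := by
  simp [mul_def]

lemma mul_smul' (c : k) (a b : PathAlgebra k V) : a * (c • b) = c • (a * b) := by
  simp [mul_def]

lemma add_mul' (a b c : PathAlgebra k V) : (a + b) * c = a * c + b * c := by
  simp [mul_def]

lemma mul_add' (a b c : PathAlgebra k V) : a * (b + c) = a * b + a * c := by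
  simp [mul_def]

lemma zero_mul' (a : PathAlgebra k V) : 0 * a = 0 := by
  simp [mul_def]

lemma mul_zero' (a : PathAlgebra k V) : a * 0 = 0 := by
  simp [mul_def]

lemma ofPath_mul_assoc (r q p : QuiverPaths V) :
    ofPath k r * ofPath k q * ofPath k p = ofPath k r * (ofPath k q * ofPath k p) := by
  obtain ⟨r₁, r₂, r⟩ := r
  obtain ⟨q₁, q₂, q⟩ := q
  obtain ⟨p₁, p₂, p⟩ := p
  simp only [ofPath_mul_ofPath]
  by_cases h₁ : q₂ = r₁
  · subst h₁
    by_cases h₂ : p₂ = q₁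
    · subst h₂
      simp only [mulPath_comp, ofPath_mul_ofPath, Quiver.Path.comp_assoc]
    · rw [mulPath_comp, ofPath_mul_ofPath, mulPath_of_ne _ _ h₂, mulPath_of_ne _ _ h₂, mul_zero']
  · rw [mulPath_of_ne _ _ h₁, zero_mul']
    by_cases h₂ : p₂ = q₁
    · subst h₂
      rw [mulPath_comp, ofPath_mul_ofPath, mulPath_of_ne _ _ h₁]
    · rw [mulPath_of_ne _ _ h₂, mul_zero']

lemma mul_assoc' (a b c : PathAlgebra k V) : a * b * c = a * (b * c) := by
  induction a using induction_on with
  | zero => simp only [zero_mul']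
  | add a a' h h' => simp only [add_mul', h, h']
  | smul s r =>
    induction b using induction_on with
    | zero => simp only [zero_mul', mul_zero']
    | add b b' h h' => simp only [add_mul', mul_add', h, h']
    | smul t q =>
      induction c using induction_on with
      | zero => simp only [mul_zero']
      | add c c' h h' => simp only [mul_add', h, h']
      | smul l p => simp only [smul_mul', mul_smul', ofPath_mul_assoc]

lemma sum_mul' [Fintype V] (f : V → PathAlgebra k V) (a : PathAlgebra k V) :
    (∑ x, f x) * a = ∑ x, f x * a := by
  simp [mul_def]

lemma mul_sum' [Fintype V] (f : V → PathAlgebra k V) (a : PathAlgebra k V) :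
    a * (∑ x, f x) = ∑ x, a * f x := by
  simp [mul_def]

lemma one_mul' [Fintype V] (a : PathAlgebra k V) : 1 * a = a := by
  induction a using induction_on with
  | zero => simp only [mul_zero']
  | add a a' h h' => simp only [mul_add', h, h']
  | smul s r =>
    obtain ⟨x, y, r⟩ := r
    rw [mul_smul', one_def, sum_mul', Finset.sum_eq_single y]
    · rw [e, ofPath_mul_ofPath, mulPath_comp, Quiver.Path.comp_nil]
    · intro z _ hz
      rw [e, ofPath_mul_ofPath, mulPath_of_ne _ _ (Ne.symm hz)]
    · simp

lemma mul_one' [Fintype V] (a : PathAlgebra k V) : a * 1 = a := by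
  induction a using induction_on with
  | zero => simp only [zero_mul']
  | add a a' h h' => simp only [add_mul', h, h']
  | smul s r =>
    obtain ⟨x, y, r⟩ := r
    rw [smul_mul', one_def, mul_sum', Finset.sum_eq_single x]
    · rw [e, ofPath_mul_ofPath, mulPath_comp, Quiver.Path.nil_comp]
    · intro z _ hz
      rw [e, ofPath_mul_ofPath, mulPath_of_ne _ _ hz]
    · simp

instance [Fintype V] : Ring (PathAlgebra k V) :=
  { (inferInstance : AddCommGroup (PathAlgebra k V)) with
    mul := fun a b => a * b
    one := 1
    left_distrib := mul_add'
    right_distrib := add_mul'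
    zero_mul := zero_mul'
    mul_zero := mul_zero'
    mul_assoc := mul_assoc'
    one_mul := one_mul'
    mul_one := mul_one' }

instance [Fintype V] : Algebra k (PathAlgebra k V) :=
  Algebra.ofModule smul_mul' mul_smul'

end PathAlgebra

/-! ## Notions in a `k`-linear abelian category -/

section Abelian

attribute [local instance] CategoryTheory.Abelian.hasFiniteBiproducts

variable (k : Type u) [Field k] {C : Type v} [Category.{w} C] [Abelian C] [Linear k C]

/-- `X` is exceptional: `Ext¹(X, X) = 0` and `End(X) = k`, i.e. every endomorphism is
multiplication by a unique scalar. -/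
def IsExceptional [HasExt.{w} C] (X : C) : Prop :=
  Subsingleton (Abelian.Ext.{w} X X 1) ∧
    Function.Bijective (fun c : k => (c • 𝟙 X : X ⟶ X))

/-- `(E 0, …, E (r - 1))` is an exceptional sequence: all members are exceptional and
`Hom(E j, E i) = 0 = Ext¹(E j, E i)` for `i < j`. -/
def IsExceptionalSequence [HasExt.{w} C] {r : ℕ} (E : Fin r → C) : Prop :=
  (∀ i, IsExceptional k (E i)) ∧
    ∀ i j, i < j → Subsingleton (E j ⟶ E i) ∧ Subsingleton (Abelian.Ext.{w} (E j) (E i) 1)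

/-- `X` is (isomorphic to) a direct summand of `Y`. -/
def IsDirectSummand (X Y : C) : Prop :=
  ∃ X' : C, Nonempty (Y ≅ X ⊞ X')

/-- `add X`: all direct summands of finite powers of `X`. -/
def addCat (X : C) : ObjectProperty C :=
  fun Y => ∃ n : ℕ, IsDirectSummand Y (⨁ fun _ : Fin n => X)

/-- The exact sequence `ξ : 0 ⟶ Y ⟶ B ⟶ T ⟶ 0` is a minimal universal extension of objects
of `add X` by `Y`: `T` lies in `add X`, every element of `Ext¹(T', Y)` with `T'` in `add X` is
a pullback of `ξ` along some `T' ⟶ T`, and every endomorphism `f` of `T` with `ξ f = ξ` is an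
isomorphism. -/
structure IsMinimalUniversalExtension [HasExt.{w} C] (X : C) (ξ : ShortComplex C)
    (hξ : ξ.ShortExact) : Prop where
  mem_add : addCat X ξ.X₃
  universal : ∀ T' : C, addCat X T' → Function.Surjective fun φ : T' ⟶ ξ.X₃ =>
    ((Abelian.Ext.mk₀ φ).comp hξ.extClass (zero_add 1) : Abelian.Ext.{w} T' ξ.X₁ 1)
  minimal : ∀ f : ξ.X₃ ⟶ ξ.X₃,
    (Abelian.Ext.mk₀ f).comp hξ.extClass (zero_add 1) =
      (hξ.extClass : Abelian.Ext.{w} ξ.X₃ ξ.X₁ 1) → IsIso f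

/-- `C(E)`: the smallest full subcategory that contains all `E i` and is closed under kernels,
cokernels and extensions. -/
def closureCat {ι : Type*} (E : ι → C) : ObjectProperty C :=
  sInf {P | (∀ i, P (E i)) ∧ P.IsClosedUnderKernels ∧ P.IsClosedUnderCokernels ∧
    P.IsClosedUnderExtensions}

lemma closureCat_mem {ι : Type*} (E : ι → C) (i : ι) : closureCat E (E i) := by
  simp only [closureCat, sInf_apply, iInf_Prop_eq]
  rintro ⟨P, hP⟩
  exact hP.1 i

end Abelian

/-! ## Modules over the path algebra -/

section Modules

variable {k : Type u} {V : Type v} [Field k] [Quiver.{w} V] [Fintype V]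

open scoped ModuleCat in
/-- The `kV`-module `M` is finite-dimensional over `k`. -/
def IsFinDim (M : ModuleCat.{max u v w} (PathAlgebra k V)) : Prop :=
  Module.Finite k M

/-- `M` is sincere: `M(x) = e_x M ≠ 0` for every vertex `x`. -/
def IsSincere (M : ModuleCat.{max u v w} (PathAlgebra k V)) : Prop :=
  ∀ x : V, ∃ m : M, PathAlgebra.e k x • m ≠ 0

variable (k V) in
/-- The regular left module. -/
def regularModule : ModuleCat.{max u v w} (PathAlgebra k V) :=
  ModuleCat.of _ (PathAlgebra k V)

variable (k) in
/-- The indecomposable projective module `P_x = (kV) e_x`. -/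
def projModule (x : V) : ModuleCat.{max u v w} (PathAlgebra k V) :=
  ModuleCat.of _ (Submodule.span (PathAlgebra k V) {PathAlgebra.e k x})

/-- `B` is a Bongartz complement of the exceptional module `M`. If `M` is projective, so
`M ≅ P_s` for a vertex `s`, then `B ≅ ⨁_{t ≠ s} P_t`. If `M` is not projective, then `B` is the
middle term of a minimal universal extension `0 ⟶ kV ⟶ B ⟶ T ⟶ 0` of objects of `add M`
by the regular module. -/
def IsBongartzComplement (M B : ModuleCat.{max u v w} (PathAlgebra k V)) : Prop :=
  (Projective M ∧ ∃ s : V, Nonempty (M ≅ projModule k s) ∧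
    Nonempty (B ≅ ⨁ fun t : {t : V // t ≠ s} => projModule k (t : V))) ∨
  (¬ Projective M ∧ ∃ (T : ModuleCat.{max u v w} (PathAlgebra k V))
    (i : regularModule k V ⟶ B) (p : B ⟶ T) (w : i ≫ p = 0)
    (hξ : (ShortComplex.mk i p w).ShortExact),
    IsMinimalUniversalExtension M (ShortComplex.mk i p w) hξ)

end Modules

end

/-! Let f : N → Mᵐ have as components a basis of Hom(N, M). Each of the two conditions amounts to:
(N, M) is an exceptional pair and f is a monomorphism.

Simplicity of M. If f is mono and M were simple in C(N, M), then N ≠ 0, sitting in a power of M,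
would receive a nonzero map from M, against Hom(M, N) = 0 (`not_simple_of_mono`). Conversely, an
argument of Happel and Ringel shows that f is mono or epi (`IsMinimalLeftApprox.mono_or_epi`). If f
is epi with kernel S ≠ 0, then S and M are Hom-orthogonal bricks; by Ringel the modules filtered by
S and M form a wide subcategory. It contains N and M, hence C(N, M), and this forces M to be simple
there (`simple_of_epi_of_not_mono`).

Summands of the complement B. Only the properties in `IsBongartzDatum` are used. If N is an
indecomposable summand of B, then N is rigid, so End N = k, and ker f embeds in the projective
kernel of B → T. Hence ker f is projective; it has no nonzero map to M, so sincerity makes it zero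
(`IsMinimalLeftApprox.mono_of_isBongartzDatum`). If f is mono, an epimorphism Aⁿ → N factors through
an epimorphism Bⁿ → N whose kernel K satisfies Ext¹(M, K) = 0. Since N embeds in Mᵐ, also Ext¹(N, K)
= 0, so N splits off Bⁿ, and End N = k reduces this to one copy of B (`isDirectSummand_of_mono`).

It remains to see that path algebras are hereditary (`PathAlgebra.isHereditary`), that complements
exist, and that they satisfy `IsBongartzDatum`. -/

open CategoryTheory CategoryTheory.Limits

/-! ## Exceptional pairs in hereditary categories -/

section Hereditary

open CategoryTheory.Abelian

attribute [local instance] CategoryTheory.Abelian.hasFiniteBiproducts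

/-- An abelian category is hereditary if `Ext²` vanishes. -/
class IsHereditary (C : Type v) [Category.{w} C] [Abelian C] [HasExt.{w} C] : Prop where
  ext_two : ∀ X Y : C, Subsingleton (Ext.{w} X Y 2)

variable {C : Type v} [Category.{w} C] [Abelian C]

lemma shortExact_kernel {X Y : C} (p : X ⟶ Y) [Epi p] :
    (ShortComplex.mk (kernel.ι p) p (kernel.condition p)).ShortExact :=
  { exact := ShortComplex.exact_kernel p }

lemma shortExact_cokernel {X Y : C} (i : X ⟶ Y) [Mono i] :
    (ShortComplex.mk i (cokernel.π i) (cokernel.condition i)).ShortExact :=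
  { exact := ShortComplex.exact_cokernel i }

lemma shortExact_coimage {X Y : C} (f : X ⟶ Y) :
    (ShortComplex.mk (kernel.ι f) (Abelian.coimage.π f)
      (cokernel.condition _)).ShortExact :=
  shortExact_cokernel (kernel.ι f)

lemma isDirectSummand_of_section {X Y : C} (s : X ⟶ Y) (r : Y ⟶ X) (h : s ≫ r = 𝟙 X) :
    IsDirectSummand X Y := by
  have : IsSplitEpi r := ⟨⟨⟨s, h⟩⟩⟩
  have hs := shortExact_kernel r
  refine ⟨kernel r, ⟨?_⟩⟩
  exact (ShortComplex.Splitting.ofExactOfSection _ hs.exact s h hs.mono_f).isoBinaryBiproduct ≪≫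
    biprod.braiding _ _

lemma exists_section_of_isDirectSummand {X Y : C} (h : IsDirectSummand X Y) :
    ∃ (s : X ⟶ Y) (r : Y ⟶ X), s ≫ r = 𝟙 X := by
  obtain ⟨X', ⟨e⟩⟩ := h
  exact ⟨biprod.inl ≫ e.inv, e.hom ≫ biprod.fst, by simp⟩

/-- The identity of `T` is a finite sum of morphisms which factor through `M`. -/
def IsRetractSum (M T : C) : Prop :=
  ∃ (n : ℕ) (s : Fin n → (T ⟶ M)) (r : Fin n → (M ⟶ T)), ∑ j, s j ≫ r j = 𝟙 T

lemma isRetractSum_of_addCat {M T : C} (h : addCat M T) : IsRetractSum M T := by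
  obtain ⟨n, h⟩ := h
  obtain ⟨s, r, hsr⟩ := exists_section_of_isDirectSummand h
  refine ⟨n, fun j => s ≫ biproduct.π _ j, fun j => biproduct.ι (fun _ : Fin n => M) j ≫ r, ?_⟩
  have := biproduct.total (f := fun _ : Fin n => M)
  calc _ = s ≫ (∑ j, biproduct.π (fun _ : Fin n => M) j ≫
          biproduct.ι (fun _ : Fin n => M) j) ≫ r := by
        simp only [Preadditive.sum_comp, Preadditive.comp_sum, Category.assoc]
    _ = 𝟙 T := by rw [this]; simpa using hsr

lemma addCat_biproduct (M : C) (n : ℕ) : addCat M (⨁ fun _ : Fin n => M) :=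
  ⟨n, isDirectSummand_of_section (𝟙 _) (𝟙 _) (by simp)⟩

lemma isRetractSum_biproduct (M : C) (n : ℕ) : IsRetractSum M (⨁ fun _ : Fin n => M) :=
  isRetractSum_of_addCat (addCat_biproduct M n)

namespace IsRetractSum

variable {M T : C} (h : IsRetractSum M T)

include h

lemma eq_zero_of_comp {X : C} {f : X ⟶ T} (hf : ∀ g : T ⟶ M, f ≫ g = 0) : f = 0 := by
  obtain ⟨n, s, r, hsr⟩ := h
  rw [← Category.comp_id f, ← hsr, Preadditive.comp_sum]
  refine Finset.sum_eq_zero fun j _ => ?_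
  rw [← Category.assoc, hf, zero_comp]

variable [HasExt.{w} C]

lemma ext_subsingleton_left {X : C} {i : ℕ} (hX : Subsingleton (Ext.{w} M X i)) :
    Subsingleton (Ext.{w} T X i) := by
  obtain ⟨n, s, r, hsr⟩ := h
  refine subsingleton_of_forall_eq 0 fun f => ?_
  rw [← Ext.mk₀_id_comp f, ← hsr, Ext.mk₀_sum, Ext.sum_comp]
  refine Finset.sum_eq_zero fun j _ => ?_
  rw [← Ext.mk₀_comp_mk₀_assoc, Subsingleton.elim ((Ext.mk₀ (r j)).comp f _) 0, Ext.comp_zero]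

lemma ext_subsingleton_right {X : C} {i : ℕ} (hX : Subsingleton (Ext.{w} X M i)) :
    Subsingleton (Ext.{w} X T i) := by
  obtain ⟨n, s, r, hsr⟩ := h
  refine subsingleton_of_forall_eq 0 fun f => ?_
  rw [← Ext.comp_mk₀_id f, ← hsr, Ext.mk₀_sum, Ext.comp_sum]
  refine Finset.sum_eq_zero fun j _ => ?_
  rw [← Ext.mk₀_comp_mk₀, ← Ext.comp_assoc_of_second_deg_zero,
    Subsingleton.elim (f.comp (Ext.mk₀ (s j)) _) 0, Ext.zero_comp]

end IsRetractSum

lemma ext_subsingleton_of_section [HasExt.{w} C] {X Y X' Y' : C} {i : ℕ} {s : X ⟶ X'}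
    {r : X' ⟶ X} (hsr : s ≫ r = 𝟙 X) {s' : Y ⟶ Y'} {r' : Y' ⟶ Y} (hsr' : s' ≫ r' = 𝟙 Y)
    (h : Subsingleton (Ext.{w} X' Y' i)) : Subsingleton (Ext.{w} X Y i) := by
  have h₁ : IsRetractSum X' X := ⟨1, fun _ => s, fun _ => r, by simpa⟩
  have h₂ : IsRetractSum Y' Y := ⟨1, fun _ => s', fun _ => r', by simpa⟩
  exact h₁.ext_subsingleton_left (h₂.ext_subsingleton_right h)

section

variable [HasExt.{w} C]

lemma exists_hom_extension {S : ShortComplex C} (hS : S.ShortExact) {Y : C}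
    (h : Subsingleton (Ext.{w} S.X₃ Y 1)) (g : S.X₁ ⟶ Y) : ∃ g' : S.X₂ ⟶ Y, S.f ≫ g' = g := by
  obtain ⟨x, hx⟩ := Ext.contravariant_sequence_exact₁ hS Y (Ext.mk₀ g) (add_zero 1)
    (Subsingleton.elim _ _)
  obtain ⟨g', rfl⟩ := Ext.addEquiv₀.symm.surjective x
  exact ⟨g', Ext.addEquiv₀.symm.injective (by simpa using hx)⟩

lemma exists_hom_lift {S : ShortComplex C} (hS : S.ShortExact) {X : C} (g : X ⟶ S.X₃)
    (h : (Ext.mk₀ g).comp hS.extClass (zero_add 1) = 0) : ∃ g' : X ⟶ S.X₂, g' ≫ S.g = g := by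
  obtain ⟨x, hx⟩ := Ext.covariant_sequence_exact₃ X hS (Ext.mk₀ g) (zero_add 1) h
  obtain ⟨g', rfl⟩ := Ext.addEquiv₀.symm.surjective x
  exact ⟨g', Ext.addEquiv₀.symm.injective (by simpa using hx)⟩

lemma ext_one_subsingleton_X₂_left {S : ShortComplex C} (hS : S.ShortExact) {Y : C} {i : ℕ}
    (h₁ : Subsingleton (Ext.{w} S.X₁ Y i)) (h₃ : Subsingleton (Ext.{w} S.X₃ Y i)) :
    Subsingleton (Ext.{w} S.X₂ Y i) := by
  refine subsingleton_of_forall_eq 0 fun x => ?_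
  obtain ⟨y, rfl⟩ := Ext.contravariant_sequence_exact₂ hS Y x (Subsingleton.elim _ _)
  rw [Subsingleton.elim y 0, Ext.comp_zero]

lemma ext_one_subsingleton_X₁_right {S : ShortComplex C} (hS : S.ShortExact) {X : C}
    (h₂ : Subsingleton (Ext.{w} X S.X₂ 1)) (h₃ : Subsingleton (X ⟶ S.X₃)) :
    Subsingleton (Ext.{w} X S.X₁ 1) := by
  refine subsingleton_of_forall_eq 0 fun x => ?_
  obtain ⟨y, rfl⟩ := Ext.covariant_sequence_exact₁ X hS x (Subsingleton.elim _ _) (zero_add 1)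
  obtain ⟨g, rfl⟩ := Ext.addEquiv₀.symm.surjective y
  rw [Subsingleton.elim g 0, map_zero, Ext.zero_comp]

variable [IsHereditary C]

/-- With the next lemma, this right exactness of Ext¹ is the only form in which the vanishing of
Ext² is used. -/
lemma ext_one_postcomp_surjective (X : C) {Y Z : C} (p : Y ⟶ Z) [Epi p] (x : Ext.{w} X Z 1) :
    ∃ y : Ext.{w} X Y 1, y.comp (Ext.mk₀ p) (add_zero 1) = x :=
  Ext.covariant_sequence_exact₃ X (shortExact_kernel p) x (n₁ := 2) rfl
    ((IsHereditary.ext_two _ _).elim _ _)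

lemma ext_one_precomp_surjective {X Y : C} (i : X ⟶ Y) [Mono i] (Z : C) (x : Ext.{w} X Z 1) :
    ∃ y : Ext.{w} Y Z 1, (Ext.mk₀ i).comp y (zero_add 1) = x :=
  Ext.contravariant_sequence_exact₁ (shortExact_cokernel i) Z x (n₁ := 2) rfl
    ((IsHereditary.ext_two _ _).elim _ _)

lemma ext_one_subsingleton_of_mono {X Y : C} (i : X ⟶ Y) [Mono i] {Z : C}
    (h : Subsingleton (Ext.{w} Y Z 1)) : Subsingleton (Ext.{w} X Z 1) := by
  refine subsingleton_of_forall_eq 0 fun x => ?_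
  obtain ⟨y, rfl⟩ := ext_one_precomp_surjective i Z x
  rw [Subsingleton.elim y 0, Ext.comp_zero]

lemma projective_of_mono {X P : C} (i : X ⟶ P) [Mono i] [Projective P] : Projective X :=
  projective_iff_subsingleton_ext_one.2 fun Y =>
    ext_one_subsingleton_of_mono i
      ((projective_iff_subsingleton_ext_one (X := P)).1 inferInstance (Y := Y))

/-- The extension class of the image of `f : X ⟶ Y` by its cokernel factors through the
coimage projection if `Ext¹(Y, X) = 0`. -/
lemma exists_extClass_eq_comp {X Y : C} (f : X ⟶ Y) (hYX : Subsingleton (Ext.{w} Y X 1)) :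
    ∃ h : Abelian.coimage f ⟶ X,
      (shortExact_cokernel (Abelian.factorThruCoimage f)).extClass.comp
        (Ext.mk₀ (h ≫ Abelian.coimage.π f)) (add_zero 1) =
      (shortExact_cokernel (Abelian.factorThruCoimage f)).extClass := by
  set hS := shortExact_cokernel (Abelian.factorThruCoimage f)
  -- Heredity lifts the class to an extension ε of coker by X; since Ext¹(Y, X) = 0, ε is a pushout
  -- of the same class along some h.
  obtain ⟨ε, hε⟩ := ext_one_postcomp_surjective _ (Abelian.coimage.π f) hS.extClass
  obtain ⟨y, hy⟩ := Ext.contravariant_sequence_exact₃ hS X ε (Subsingleton.elim _ _) (add_zero 1)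
  obtain ⟨h, rfl⟩ := Ext.addEquiv₀.symm.surjective y
  refine ⟨h, ?_⟩
  rw [← Ext.mk₀_comp_mk₀, ← Ext.comp_assoc_of_second_deg_zero,
    show hS.extClass.comp (Ext.mk₀ h) (add_zero 1) = ε from hy, hε]

/-- A left approximation of `N` by sums of copies of `M` given by a basis of `Hom(N, M)`. -/
structure IsMinimalLeftApprox (M : C) {N T : C} (f : N ⟶ T) : Prop where
  retractSum : IsRetractSum M T
  factor : ∀ g : N ⟶ M, ∃ h : T ⟶ M, f ≫ h = g
  unique : ∀ h : T ⟶ M, f ≫ h = 0 → h = 0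

/-- A variant of a lemma of Happel and Ringel. -/
lemma IsMinimalLeftApprox.mono_or_epi {k : Type u} [Field k] [Linear k C] {M N T : C} {f : N ⟶ T}
    (hf : IsMinimalLeftApprox M f)
    (hN : Function.Surjective (fun c : k => (c • 𝟙 N : N ⟶ N)))
    (hMN : Subsingleton (Ext.{w} M N 1)) : Mono f ∨ Epi f := by
  obtain ⟨h, hh⟩ := exists_extClass_eq_comp f (hf.retractSum.ext_subsingleton_left hMN)
  obtain ⟨c, hc⟩ := hN (Abelian.coimage.π f ≫ h)
  dsimp only at hc
  -- The endomorphism N → coim f → N is a scalar c. If c = 0, the image of f splits off T; if c ≠ 0,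
  -- then f is mono.
  by_cases hc0 : c = 0
  · right
    have hh0 : h = 0 := by
      rw [← cancel_epi (Abelian.coimage.π f), ← hc, hc0, zero_smul, comp_zero]
    rw [hh0, zero_comp, Ext.mk₀_zero, Ext.comp_zero] at hh
    obtain ⟨s, hs⟩ := exists_hom_lift (shortExact_cokernel (Abelian.factorThruCoimage f)) (𝟙 _)
      (by rw [← hh, Ext.comp_zero])
    dsimp at s hs
    have hfq : f ≫ cokernel.π (Abelian.factorThruCoimage f) = 0 :=
      ((Abelian.coimage.fac f).symm =≫ _).trans
        (by rw [Category.assoc, cokernel.condition, comp_zero])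
    -- The idempotent of T onto the complement of the image kills f, so minimality of the
    -- approximation makes it zero.
    have hq : cokernel.π (Abelian.factorThruCoimage f) ≫ s = 0 :=
      hf.retractSum.eq_zero_of_comp fun g => hf.unique _ (by simp [reassoc_of% hfq])
    have hq' : cokernel.π (Abelian.factorThruCoimage f) = 0 := by
      rw [← Category.comp_id (cokernel.π _), ← hs, reassoc_of% hq, zero_comp]
    have := Preadditive.epi_of_cokernel_zero hq'
    rw [← Abelian.coimage.fac f]
    infer_instance
  · left
    have : Mono (Abelian.coimage.π f) := by
      have : IsIso (Abelian.coimage.π f ≫ h) :=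
        ⟨c⁻¹ • 𝟙 N, by simp [← hc, smul_smul, hc0], by simp [← hc, smul_smul, hc0]⟩
      exact mono_of_mono _ h
    rw [← Abelian.coimage.fac f]
    infer_instance

/-- The lemma of Happel and Ringel for endomorphisms. -/
lemma isIso_of_ne_zero_of_indecomposable {N : C} (hN : Indecomposable N)
    (hext : Subsingleton (Ext.{w} N N 1))
    (hfit : ∀ g : End N, IsIso (C := C) g ∨ IsNilpotent g) (f : N ⟶ N) (hf : f ≠ 0) :
    IsIso f := by
  have hid : (1 : End N) ≠ 0 := fun h => hN.1 ((IsZero.iff_id_eq_zero N).2 h)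
  have hmono : Mono f → IsIso f := fun _ => by
    refine (hfit f).resolve_right ?_
    rintro ⟨n, hn⟩
    induction n with
    | zero => exact hid (by simpa using hn)
    | succ n ih =>
      refine ih ?_
      rw [pow_succ', End.mul_def] at hn
      exact zero_of_comp_mono f hn
  have hepi : Epi f → IsIso f := fun _ => by
    refine (hfit f).resolve_right ?_
    rintro ⟨n, hn⟩
    induction n with
    | zero => exact hid (by simpa using hn)
    | succ n ih =>
      refine ih ?_
      rw [pow_succ, End.mul_def] at hn
      exact zero_of_epi_comp f hn
  obtain ⟨h, hh⟩ := exists_extClass_eq_comp f hext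
  -- If g = π h is invertible, f is mono. If g is nilpotent, iterating the identity for η gives η =
  -- 0, so the image splits off N and indecomposability applies.
  rcases hfit (Abelian.coimage.π f ≫ h) with hg | ⟨n, hn⟩
  · refine hmono ?_
    have : Mono (Abelian.coimage.π f) := mono_of_mono _ h
    rw [← Abelian.coimage.fac f]
    infer_instance
  · set η := (shortExact_cokernel (Abelian.factorThruCoimage f)).extClass
    let g : End N := Abelian.coimage.π f ≫ h
    have key : ∀ n : ℕ, η.comp (Ext.mk₀ (h ≫ (g ^ n : End N) ≫ Abelian.coimage.π f))
        (add_zero 1) = η := by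
      intro n
      induction n with
      | zero => simpa [End.one_def] using hh
      | succ n ih =>
        conv_rhs => rw [← ih, ← hh]
        rw [Ext.comp_assoc_of_second_deg_zero, Ext.mk₀_comp_mk₀]
        simp [pow_succ, End.mul_def, g]
    have h0 : η = 0 := by
      rw [← key n, hn]
      simp
    obtain ⟨s, hs⟩ := exists_hom_lift (shortExact_cokernel (Abelian.factorThruCoimage f)) (𝟙 _)
      (by change (Ext.mk₀ _).comp η _ = 0; rw [h0, Ext.comp_zero])
    have e := (ShortComplex.Splitting.ofExactOfSection _
      (shortExact_cokernel (Abelian.factorThruCoimage f)).exact s hs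
      (shortExact_cokernel (Abelian.factorThruCoimage f)).mono_f).isoBinaryBiproduct
    rcases hN.2 _ _ e with h1 | h1
    · exact absurd (by rw [← Abelian.coimage.fac f]; exact h1.eq_of_tgt _ 0 =≫ _ |>.trans zero_comp)
        hf
    · refine hepi ?_
      have := Preadditive.epi_of_cokernel_zero (f := Abelian.factorThruCoimage f)
        (h1.eq_of_tgt _ _)
      rw [← Abelian.coimage.fac f]
      infer_instance

end

end Hereditary

/-! ## Modules filtered by a semibrick -/

section Filtered

variable {R : Type u} [Ring R]

lemma LinearMap.exists_comp_eq_of_surjective {X Y Z : Type*} [AddCommGroup X] [AddCommGroup Y]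
    [AddCommGroup Z] [Module R X] [Module R Y] [Module R Z] {p : X →ₗ[R] Y}
    (hp : Function.Surjective p) (g : X →ₗ[R] Z) (h : ∀ x, p x = 0 → g x = 0) :
    ∃ g' : Y →ₗ[R] Z, ∀ x, g' (p x) = g x := by
  have hker : LinearMap.ker p ≤ LinearMap.ker g := fun x hx => h x hx
  refine ⟨(LinearMap.ker p).liftQ g hker ∘ₗ (p.quotKerEquivOfSurjective hp).symm, fun x => ?_⟩
  have : (p.quotKerEquivOfSurjective hp).symm (p x) = (LinearMap.ker p).mkQ x := by
    rw [LinearEquiv.symm_apply_eq]; rfl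
  rw [LinearMap.comp_apply, LinearEquiv.coe_coe, this]
  simp

lemma LinearMap.exists_comp_eq_of_injective {X Y Z : Type*} [AddCommGroup X] [AddCommGroup Y]
    [AddCommGroup Z] [Module R X] [Module R Y] [Module R Z] {i : X →ₗ[R] Y}
    (hi : Function.Injective i) (g : Z →ₗ[R] Y) (h : ∀ z, ∃ x, i x = g z) :
    ∃ g' : Z →ₗ[R] X, ∀ z, i (g' z) = g z := by
  refine ⟨(LinearEquiv.ofInjective i hi).symm ∘ₗ
    g.codRestrict (LinearMap.range i) (fun z => h z), fun z => ?_⟩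
  have := (LinearEquiv.ofInjective i hi).apply_symm_apply
    (g.codRestrict (LinearMap.range i) (fun z => h z) z)
  exact congrArg Subtype.val this

/-- Modules with a finite filtration whose factors satisfy `𝒮`. -/
inductive FilteredBy (𝒮 : ModuleCat.{v} R → Prop) : ModuleCat.{v} R → Prop
  | zero (X : ModuleCat.{v} R) (h : Subsingleton X) : FilteredBy 𝒮 X
  | cons (S X Y : ModuleCat.{v} R) (i : S →ₗ[R] X) (p : X →ₗ[R] Y) (hi : Function.Injective i)
      (hp : Function.Surjective p) (hip : Function.Exact i p) (hS : 𝒮 S) (hY : FilteredBy 𝒮 Y) :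
      FilteredBy 𝒮 X

namespace FilteredBy

variable {𝒮 : ModuleCat.{v} R → Prop}

lemma of_equiv {X Y : ModuleCat.{v} R} (hX : FilteredBy 𝒮 X) (e : X ≃ₗ[R] Y) :
    FilteredBy 𝒮 Y := by
  cases hX with
  | zero _ h => exact .zero _ e.symm.toEquiv.subsingleton
  | cons S _ Z i p hi hp hip hS hZ =>
    refine .cons S Y Z (e.toLinearMap ∘ₗ i) (p ∘ₗ e.symm.toLinearMap) (e.injective.comp hi)
      (hp.comp e.symm.surjective) (fun y => ?_) hS hZ
    have := hip (e.symm y)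
    simp only [LinearMap.comp_apply, LinearEquiv.coe_coe, this, Set.mem_range]
    exact exists_congr fun x => (e.eq_symm_apply)

lemma of_mem {X : ModuleCat.{v} R} (hX : 𝒮 X) : FilteredBy 𝒮 X :=
  .cons X X (ModuleCat.of R PUnit) LinearMap.id 0 Function.injective_id
    (fun _ => ⟨0, Subsingleton.elim _ _⟩) (fun x => by simp) hX (.zero _ inferInstance)

/-- Induction on the filtration of X: divide E by the bottom factor S of X, so that E/S is an
extension of Z by X/S. -/
lemma extension {X : ModuleCat.{v} R} (hX : FilteredBy 𝒮 X) :
    ∀ {E Z : ModuleCat.{v} R} (i : X →ₗ[R] E) (p : E →ₗ[R] Z), Function.Injective i →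
      Function.Surjective p → Function.Exact i p → FilteredBy 𝒮 Z → FilteredBy 𝒮 E := by
  induction hX with
  | zero X h =>
    intro E Z i p hi hp hip hZ
    refine hZ.of_equiv (LinearEquiv.ofBijective p ⟨?_, hp⟩).symm
    rw [injective_iff_map_eq_zero]
    intro x hx
    obtain ⟨y, rfl⟩ := (hip x).1 hx
    rw [Subsingleton.elim y 0, map_zero]
  | cons S X Y j q hj hq hjq hS hY ih =>
    intro E Z i p hi hp hip hZ
    let A := LinearMap.range (i ∘ₗ j)
    have hjz : ∀ s, q (j s) = 0 := fun s => (hjq _).2 ⟨s, rfl⟩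
    have hiz : ∀ s, p (i s) = 0 := fun s => (hip _).2 ⟨s, rfl⟩
    obtain ⟨i', hi'⟩ := LinearMap.exists_comp_eq_of_surjective hq (A.mkQ ∘ₗ i) (by
      intro x hx
      obtain ⟨s, rfl⟩ := (hjq x).1 hx
      simpa using ⟨s, rfl⟩)
    have hA : A ≤ LinearMap.ker p := by
      rintro _ ⟨s, rfl⟩
      exact hiz _
    have hE : FilteredBy 𝒮 (ModuleCat.of R (E ⧸ A)) := by
      refine ih i' (A.liftQ p hA) ?_ ?_ ?_ hZ
      · rw [injective_iff_map_eq_zero]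
        intro y hy
        obtain ⟨x, rfl⟩ := hq y
        rw [hi'] at hy
        obtain ⟨s, hs⟩ := (Submodule.Quotient.mk_eq_zero A).1 hy
        rw [← hi hs]
        exact hjz s
      · intro z
        obtain ⟨x, rfl⟩ := hp z
        exact ⟨A.mkQ x, by simp⟩
      · intro e
        obtain ⟨e, rfl⟩ := A.mkQ_surjective e
        constructor
        · intro he
          obtain ⟨x, rfl⟩ := (hip e).1 (by simpa using he)
          exact ⟨q x, hi' x⟩
        · rintro ⟨y, hy⟩
          obtain ⟨x, rfl⟩ := hq y
          rw [← hy, hi']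
          simpa using hiz x
    refine .cons S E (ModuleCat.of R (E ⧸ A)) (i ∘ₗ j) A.mkQ (hi.comp hj) A.mkQ_surjective ?_ hS hE
    intro e
    exact Submodule.Quotient.mk_eq_zero A

/-- A nonzero morphism from a member of a semibrick to a filtered module is a monomorphism with
filtered cokernel. -/
lemma injective_and_quotient
    (h𝒮 : ∀ S S' : ModuleCat.{v} R, 𝒮 S → 𝒮 S' → ∀ g : S →ₗ[R] S', g ≠ 0 → Function.Bijective g)
    {S Y : ModuleCat.{v} R} (hS : 𝒮 S) (hY : FilteredBy 𝒮 Y) :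
    ∀ f : S →ₗ[R] Y, f ≠ 0 →
      Function.Injective f ∧ FilteredBy 𝒮 (ModuleCat.of R (Y ⧸ LinearMap.range f)) := by
  induction hY with
  | zero Y h => exact fun f hf => absurd (LinearMap.ext fun x => Subsingleton.elim _ _) hf
  | cons S' Y Y' i p hi hp hip hS' hY' ih =>
    intro f hf
    have hz : ∀ s, p (i s) = 0 := fun s => (hip _).2 ⟨s, rfl⟩
    -- Either f lands in the bottom factor S' and is an isomorphism onto it, or its composite to Y'
    -- is nonzero and induction applies there.
    by_cases hpf : p ∘ₗ f = 0
    · obtain ⟨g, hg⟩ := LinearMap.exists_comp_eq_of_injective hi f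
        (fun z => (hip _).1 (LinearMap.congr_fun hpf z))
      have hgf : f = i ∘ₗ g := LinearMap.ext fun z => (hg z).symm
      have hgb : Function.Bijective g := h𝒮 _ _ hS hS' g (fun h => hf (by rw [hgf, h]; simp))
      have hr : LinearMap.range f = LinearMap.ker p := by
        rw [hgf, LinearMap.range_comp_of_range_eq_top _ (LinearMap.range_eq_top.2 hgb.2)]
        exact (LinearMap.exact_iff.1 hip).symm
      refine ⟨by rw [hgf]; exact hi.comp hgb.1, hY'.of_equiv ?_⟩
      exact ((Submodule.quotEquivOfEq _ _ hr).trans (p.quotKerEquivOfSurjective hp)).symm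
    · obtain ⟨hinj, hfil⟩ := ih _ hpf
      have hfi : Function.Injective f := Function.Injective.of_comp (f := p) hinj
      refine ⟨hfi, ?_⟩
      refine .cons S' _ _ ((LinearMap.range f).mkQ ∘ₗ i) (Submodule.mapQ _ _ p ?_) ?_ ?_ ?_ hS' hfil
      · rintro _ ⟨s, rfl⟩
        exact ⟨s, rfl⟩
      · rw [injective_iff_map_eq_zero]
        intro s hs
        obtain ⟨t, ht⟩ := (Submodule.Quotient.mk_eq_zero _).1 hs
        have : t = 0 := by
          apply (injective_iff_map_eq_zero _).1 hinj
          rw [LinearMap.comp_apply, ht, hz]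
        rw [this, map_zero] at ht
        exact (injective_iff_map_eq_zero _).1 hi _ ht.symm
      · intro y
        obtain ⟨y, rfl⟩ := Submodule.mkQ_surjective _ y
        obtain ⟨x, rfl⟩ := hp y
        exact ⟨Submodule.mkQ _ x, rfl⟩
      · intro y
        obtain ⟨y, rfl⟩ := Submodule.mkQ_surjective _ y
        constructor
        · intro hy
          obtain ⟨s, hs⟩ := (Submodule.Quotient.mk_eq_zero _).1 hy
          obtain ⟨t, ht⟩ := (hip (y - f s)).1 (by rw [map_sub, ← hs]; simp)
          refine ⟨t, ?_⟩
          rw [LinearMap.comp_apply, ht, map_sub, sub_eq_self]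
          exact (Submodule.Quotient.mk_eq_zero _).2 ⟨s, rfl⟩
        · rintro ⟨s, hs⟩
          rw [← hs]
          change Submodule.mkQ _ (p (i s)) = 0
          rw [hz, map_zero]

/-- Ringel: the modules filtered by a semibrick are closed under kernels and cokernels. -/
lemma ker_and_quotient
    (h𝒮 : ∀ S S' : ModuleCat.{v} R, 𝒮 S → 𝒮 S' → ∀ g : S →ₗ[R] S', g ≠ 0 → Function.Bijective g)
    {X : ModuleCat.{v} R} (hX : FilteredBy 𝒮 X) :
    ∀ {Y : ModuleCat.{v} R} (_ : FilteredBy 𝒮 Y) (f : X →ₗ[R] Y),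
      FilteredBy 𝒮 (ModuleCat.of R (LinearMap.ker f)) ∧
        FilteredBy 𝒮 (ModuleCat.of R (Y ⧸ LinearMap.range f)) := by
  induction hX with
  | zero X h =>
    intro Y hY f
    refine ⟨.zero _ ⟨fun a b => Subtype.ext (Subsingleton.elim (α := X) _ _)⟩, ?_⟩
    have hr : LinearMap.range f = ⊥ := by
      rw [LinearMap.range_eq_bot]
      exact LinearMap.ext fun x => by rw [Subsingleton.elim x 0, map_zero, map_zero]
    exact hY.of_equiv ((Submodule.quotEquivOfEqBot _ hr).symm)
  | cons S X X' i p hi hp hip hS hX' ih =>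
    intro Y hY f
    have hz : ∀ s, p (i s) = 0 := fun s => (hip _).2 ⟨s, rfl⟩
    -- If f kills the bottom factor S, pass to X' → Y. Otherwise S embeds in Y with filtered
    -- cokernel, and X' → Y/S has the same kernel and cokernel as f.
    by_cases hfi : f ∘ₗ i = 0
    · obtain ⟨f', hf'⟩ := LinearMap.exists_comp_eq_of_surjective hp f (by
        intro x hx
        obtain ⟨s, rfl⟩ := (hip x).1 hx
        exact LinearMap.congr_fun hfi s)
      obtain ⟨hk, hc⟩ := ih hY f'
      constructor
      · refine .cons S _ _ (i.codRestrict (LinearMap.ker f) (LinearMap.congr_fun hfi))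
          ((p ∘ₗ (LinearMap.ker f).subtype).codRestrict (LinearMap.ker f')
            (fun x => (hf' _).trans x.2)) ?_ ?_ ?_ hS hk
        · intro a b hab
          exact hi (congrArg Subtype.val hab)
        · rintro ⟨y, hy⟩
          obtain ⟨x, rfl⟩ := hp y
          exact ⟨⟨x, by rw [LinearMap.mem_ker, ← hf']; exact hy⟩, rfl⟩
        · rintro ⟨x, hx⟩
          rw [← Subtype.coe_inj]
          refine (hip x).trans ⟨?_, ?_⟩
          · rintro ⟨s, hs⟩
            exact ⟨s, Subtype.ext hs⟩
          · rintro ⟨s, hs⟩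
            exact ⟨s, congrArg Subtype.val hs⟩
      · refine hc.of_equiv (Submodule.quotEquivOfEq _ _ ?_)
        have : f = f' ∘ₗ p := LinearMap.ext fun x => (hf' x).symm
        rw [this, LinearMap.range_comp_of_range_eq_top _ (LinearMap.range_eq_top.2 hp)]
    · obtain ⟨hinj, hfil⟩ := injective_and_quotient h𝒮 hS hY _ hfi
      obtain ⟨f', hf'⟩ := LinearMap.exists_comp_eq_of_surjective hp
        ((LinearMap.range (f ∘ₗ i)).mkQ ∘ₗ f) (by
        intro x hx
        obtain ⟨s, rfl⟩ := (hip x).1 hx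
        exact (Submodule.Quotient.mk_eq_zero _).2 ⟨s, rfl⟩)
      obtain ⟨hk, hc⟩ := ih hfil f'
      constructor
      · refine hk.of_equiv (LinearEquiv.ofBijective
          ((p ∘ₗ (LinearMap.ker f).subtype).codRestrict (LinearMap.ker f')
            (fun x => (hf' _).trans ?_)) ⟨?_, ?_⟩).symm
        · rw [LinearMap.comp_apply, Submodule.subtype_apply, LinearMap.mem_ker.1 x.2, map_zero]
        · rw [injective_iff_map_eq_zero]
          rintro ⟨x, hx⟩ h
          obtain ⟨s, rfl⟩ := (hip x).1 (congrArg Subtype.val h)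
          have : s = 0 := (injective_iff_map_eq_zero _).1 hinj _ hx
          exact Subtype.ext (by simp [this])
        · rintro ⟨y, hy⟩
          obtain ⟨x, rfl⟩ := hp y
          rw [LinearMap.mem_ker, hf'] at hy
          obtain ⟨s, hs⟩ := (Submodule.Quotient.mk_eq_zero _).1 hy
          refine ⟨⟨x - i s, ?_⟩, Subtype.ext ?_⟩
          · rw [LinearMap.mem_ker, map_sub, ← hs]
            simp
          · change p (x - i s) = p x
            rw [map_sub, hz, sub_zero]
      · let q : Y →ₗ[R] _ := (LinearMap.range f').mkQ ∘ₗ (LinearMap.range (f ∘ₗ i)).mkQ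
        have hq : Function.Surjective q :=
          (Submodule.mkQ_surjective _).comp (Submodule.mkQ_surjective _)
        have hr : LinearMap.range f = LinearMap.ker q := by
          ext y
          constructor
          · rintro ⟨x, rfl⟩
            exact (Submodule.Quotient.mk_eq_zero _).2 ⟨p x, hf' x⟩
          · intro hy
            obtain ⟨x', hx'⟩ := (Submodule.Quotient.mk_eq_zero _).1 (LinearMap.mem_ker.1 hy)
            obtain ⟨x, rfl⟩ := hp x'
            rw [hf', ← sub_eq_zero, LinearMap.comp_apply, ← map_sub] at hx'
            obtain ⟨s, hs⟩ := (Submodule.Quotient.mk_eq_zero _).1 hx'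
            refine ⟨x - i s, ?_⟩
            rw [map_sub, ← LinearMap.comp_apply, hs]
            simp
        exact hc.of_equiv
          ((Submodule.quotEquivOfEq _ _ hr).trans (q.quotKerEquivOfSurjective hq)).symm

/-- The modules filtered by a semibrick form a wide subcategory. -/
lemma closureCat_le
    (h𝒮 : ∀ S S' : ModuleCat.{v} R, 𝒮 S → 𝒮 S' → ∀ g : S →ₗ[R] S', g ≠ 0 → Function.Bijective g)
    {ι : Type*} {E : ι → ModuleCat.{v} R} (hE : ∀ i, FilteredBy 𝒮 (E i)) {X : ModuleCat.{v} R}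
    (hX : closureCat E X) : FilteredBy 𝒮 X := by
  have : closureCat E ≤ FilteredBy 𝒮 := by
    refine sInf_le ⟨hE, ⟨?_⟩, ⟨?_⟩, ⟨?_⟩⟩
    · rintro _ ⟨f, c, hc, hf⟩
      exact (ker_and_quotient h𝒮 hf.1 hf.2 f.hom).1.of_equiv
        ((ModuleCat.kernelIsLimit f).conePointUniqueUpToIso hc).toLinearEquiv
    · rintro _ ⟨f, c, hc, hf⟩
      exact (ker_and_quotient h𝒮 hf.1 hf.2 f.hom).2.of_equiv
        ((ModuleCat.cokernelIsColimit f).coconePointUniqueUpToIso hc).toLinearEquiv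
    · intro S hS h₁ h₃
      have := hS.mono_f
      have := hS.epi_g
      exact h₁.extension S.f.hom S.g.hom ((ModuleCat.mono_iff_injective _).1 inferInstance)
        ((ModuleCat.epi_iff_surjective _).1 inferInstance)
        ((ShortComplex.ShortExact.moduleCat_exact_iff_function_exact _).1 hS.exact) h₃
  exact this X hX

lemma pi {M : ModuleCat.{v} R} (hM : FilteredBy 𝒮 M) (n : ℕ) :
    FilteredBy 𝒮 (ModuleCat.of R (Fin n → M)) := by
  induction n with
  | zero => exact .zero _ (inferInstanceAs (Subsingleton (Fin 0 → M)))
  | succ n ih =>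
    refine hM.extension (E := ModuleCat.of R (Fin (n + 1) → M))
      (LinearMap.single R (fun _ : Fin (n + 1) => M) 0) (LinearMap.funLeft R M Fin.succ)
      (Pi.single_injective (M := fun _ : Fin (n + 1) => M) 0) (fun g => ⟨Fin.cons 0 g, ?_⟩) (fun g => ?_) ih
    · ext j
      simp [LinearMap.funLeft_apply]
    · constructor
      · intro hg
        refine ⟨g 0, ?_⟩
        ext j
        refine Fin.cases ?_ (fun j => ?_) j
        · simp
        · rw [LinearMap.single_apply, Pi.single_eq_of_ne (Fin.succ_ne_zero j)]
          exact (congrFun hg j).symm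
      · rintro ⟨m, rfl⟩
        ext j
        rw [LinearMap.funLeft_apply, LinearMap.single_apply,
          Pi.single_eq_of_ne (Fin.succ_ne_zero j)]
        rfl

end FilteredBy

end Filtered

/-! ### Simple objects in subcategories closed under kernels -/

section ClosureCat

open CategoryTheory.Abelian

attribute [local instance] CategoryTheory.Abelian.hasFiniteBiproducts

instance {C : Type v} [Category.{w} C] [Abelian C] {ι : Type*} (E : ι → C) :
    (closureCat E).IsClosedUnderKernels where
  kernels_le := by
    rintro _ ⟨f, c, hc, hf⟩
    simp only [closureCat, sInf_apply, iInf_Prop_eq] at hf ⊢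
    rintro ⟨P, hP⟩
    exact hP.2.1.kernels_le _ (.of_isLimit f c hc
      ⟨by have := hf.1; simp only [sInf_apply, iInf_Prop_eq] at this; exact this ⟨P, hP⟩,
        by have := hf.2; simp only [sInf_apply, iInf_Prop_eq] at this; exact this ⟨P, hP⟩⟩)

variable {C : Type v} [Category.{w} C] [Abelian C]

/-- If `M` is simple in `P`, then it maps nontrivially to every nonzero object of `P` which embeds
into a power of `M`. -/
lemma exists_hom_ne_zero_of_simple {P : ObjectProperty C} [P.IsClosedUnderKernels] {M : C}
    (hM : P M) [Simple (⟨M, hM⟩ : P.FullSubcategory)] (n : ℕ) :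
    ∀ {X : C} (_ : P X) (_ : ¬ IsZero X) (i : Fin n → (X ⟶ M))
      (_ : ∀ (Z : C) (z : Z ⟶ X), (∀ j, z ≫ i j = 0) → z = 0), ∃ g : M ⟶ X, g ≠ 0 := by
  induction n with
  | zero =>
    intro X _ hX i hi
    exact absurd ((IsZero.iff_id_eq_zero X).2 (hi X (𝟙 X) (fun j => j.elim0))) hX
  | succ n ih =>
    intro X hPX hX i hi
    -- A nonzero first coordinate is either mono, hence an isomorphism onto the simple M, or has a
    -- nonzero kernel, which the remaining n coordinates embed.
    by_cases hi0 : i 0 = 0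
    · refine ih hPX hX (fun j => i j.succ) fun Z z hz => hi Z z fun j => ?_
      refine Fin.cases ?_ (fun j => ?_) j
      · rw [hi0, comp_zero]
      · exact hz j
    by_cases hK : IsZero (kernel (i 0))
    · have hmono : Mono (i 0) := Preadditive.mono_of_kernel_zero (hK.eq_of_src _ _)
      let g : (⟨X, hPX⟩ : P.FullSubcategory) ⟶ ⟨M, hM⟩ := P.homMk (i 0)
      have hg : Mono g := P.ι.mono_of_mono_map hmono
      have : IsIso g := isIso_of_mono_of_nonzero fun h => hi0 (congrArg (fun f => f.hom) h)
      refine ⟨(inv g).hom, fun h => id_nonzero (⟨M, hM⟩ : P.FullSubcategory) ?_⟩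
      rw [← IsIso.inv_hom_id g]
      ext
      rw [ObjectProperty.FullSubcategory.comp_hom, h, zero_comp]
      rfl
    · obtain ⟨g, hg⟩ := ih (P.prop_kernel (i 0) hPX hM) hK (fun j => kernel.ι _ ≫ i j.succ)
        fun Z z hz => by
          rw [← cancel_mono (kernel.ι (i 0)), zero_comp]
          refine hi Z _ fun j => ?_
          refine Fin.cases ?_ (fun j => ?_) j
          · rw [Category.assoc, kernel.condition, comp_zero]
          · simpa using hz j
      exact ⟨g ≫ kernel.ι _, fun h => hg (zero_of_comp_mono _ h)⟩

lemma not_simple_of_mono {N M T : C} (f : N ⟶ T) [Mono f] (hT : IsRetractSum M T)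
    (hN : ¬ IsZero N) (hMN : Subsingleton (M ⟶ N)) :
    ¬ Simple (⟨M, closureCat_mem ![N, M] 1⟩ : (closureCat ![N, M]).FullSubcategory) := by
  intro h
  obtain ⟨n, s, r, hsr⟩ := hT
  obtain ⟨g, hg⟩ := exists_hom_ne_zero_of_simple
    (show closureCat ![N, M] M from closureCat_mem ![N, M] 1) n
    (show closureCat ![N, M] N from closureCat_mem ![N, M] 0) hN (fun j => f ≫ s j) fun Z z hz => by
      rw [← cancel_mono f, zero_comp, ← Category.comp_id (z ≫ f), ← hsr, Preadditive.comp_sum]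
      refine Finset.sum_eq_zero fun j _ => ?_
      rw [← Category.assoc, Category.assoc z, hz j, zero_comp]
  exact hg (hMN.elim _ _)

end ClosureCat

/-! ### Simplicity of M in C(N, M) when the approximation is a proper epimorphism -/

section ModuleSimple

open CategoryTheory.Abelian

attribute [local instance] CategoryTheory.Abelian.hasFiniteBiproducts

variable {k : Type u} [Field k] {R : Type v} [Ring R] [Algebra k R]

lemma bijective_hom_iff_isIso {X Y : ModuleCat.{w} R} (f : X ⟶ Y) :
    Function.Bijective f.hom ↔ IsIso f := by
  rw [ConcreteCategory.isIso_iff_bijective]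

/-- If the minimal left approximation `N ⟶ Mⁿ` is an epimorphism but not a monomorphism, then
`M` is simple in `C(N, M)`. -/
lemma simple_of_epi_of_not_mono [HasExt.{w} (ModuleCat.{w} R)] {N M : ModuleCat.{w} R} {n : ℕ}
    {f : N ⟶ ⨁ fun _ : Fin n => M} [Epi f]
    (hf : IsMinimalLeftApprox M f) (hnm : ¬ Mono f)
    (hN : Function.Surjective (fun c : k => (c • 𝟙 N : N ⟶ N)))
    (hM : Function.Bijective (fun c : k => (c • 𝟙 M : M ⟶ M)))
    (hMM : Subsingleton (Ext.{w} M M 1))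
    (hMN : Subsingleton (M ⟶ N)) (hMN' : Subsingleton (Ext.{w} M N 1)) :
    Simple (⟨M, closureCat_mem ![N, M] 1⟩ : (closureCat ![N, M]).FullSubcategory) := by
  have hM0 : 𝟙 M ≠ 0 := fun h => one_ne_zero (hM.1 (a₁ := (1 : k)) (a₂ := 0) (by simp [h]))
  have hS := shortExact_kernel f
  set S := kernel f
  have hS0 : ¬ IsZero S := fun h =>
    hnm (Preadditive.mono_of_kernel_zero (h.eq_of_src _ _))
  -- Since Ext¹(T, M) = 0, g extends to N; the extension factors through f and so dies on the kernel
  -- S.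
  have hSM : ∀ g : S ⟶ M, g = 0 := fun g => by
    obtain ⟨g', hg'⟩ := exists_hom_extension hS (hf.retractSum.ext_subsingleton_left hMM) g
    obtain ⟨h, rfl⟩ := hf.factor g'
    rw [← hg']
    simp
  have hMS : ∀ g : M ⟶ S, g = 0 := fun g => by
    rw [← cancel_mono (kernel.ι f)]
    exact hMN.elim _ _
  have hscal : ∀ {X : ModuleCat.{w} R} {c : k} (g : X ⟶ X), c • 𝟙 X = g → g ≠ 0 → IsIso g := by
    intro X c g hc hg
    have hc0 : c ≠ 0 := fun h => hg (by rw [← hc, h, zero_smul])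
    exact ⟨c⁻¹ • 𝟙 X, by simp [← hc, smul_smul, hc0], by simp [← hc, smul_smul, hc0]⟩
  -- Since Ext¹(T, N) = 0, g extends to an endomorphism of N, which is a scalar.
  have hSS : ∀ g : S ⟶ S, g ≠ 0 → IsIso g := fun g hg => by
    obtain ⟨g', hg'⟩ := exists_hom_extension hS (hf.retractSum.ext_subsingleton_left hMN')
      (g ≫ kernel.ι f)
    obtain ⟨c, rfl⟩ := hN g'
    refine hscal g (c := c) ?_ hg
    rw [← cancel_mono (kernel.ι f), ← hg']
    simp
  let 𝒮 : ModuleCat.{w} R → Prop := fun X => Nonempty (X ≅ S) ∨ Nonempty (X ≅ M)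
  have h𝒮 : ∀ X Y : ModuleCat.{w} R, 𝒮 X → 𝒮 Y → ∀ g : X →ₗ[R] Y, g ≠ 0 →
      Function.Bijective g := by
    intro X Y hX hY g hg
    change Function.Bijective (ModuleCat.ofHom g).hom
    rw [bijective_hom_iff_isIso]
    have hg' : ModuleCat.ofHom g ≠ 0 := fun h => hg (congrArg ModuleCat.Hom.hom h)
    have key : ∀ {X' Y' : ModuleCat.{w} R} (a : X ≅ X') (b : Y ≅ Y'),
        (∀ h : X' ⟶ Y', h ≠ 0 → IsIso h) → IsIso (ModuleCat.ofHom g) := by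
      intro X' Y' a b h
      have : IsIso (a.inv ≫ ModuleCat.ofHom g ≫ b.hom) := h _ fun h0 => hg' (by
        rw [← cancel_epi a.inv, ← cancel_mono b.hom, Category.assoc, h0]; simp)
      have h2 : ModuleCat.ofHom g = a.hom ≫ (a.inv ≫ ModuleCat.ofHom g ≫ b.hom) ≫ b.inv := by
        simp
      rw [h2]
      infer_instance
    rcases hX with ⟨⟨a⟩⟩ | ⟨⟨a⟩⟩ <;> rcases hY with ⟨⟨b⟩⟩ | ⟨⟨b⟩⟩
    · exact key a b hSS
    · exact key a b fun h h0 => absurd (hSM h) h0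
    · exact key a b fun h h0 => absurd (hMS h) h0
    · exact key a b fun h h0 => by
        obtain ⟨c, hc⟩ := hM.2 h
        exact hscal h hc h0
  have hSf : FilteredBy 𝒮 S := .of_mem (Or.inl ⟨Iso.refl _⟩)
  have hMf : FilteredBy 𝒮 M := .of_mem (Or.inr ⟨Iso.refl _⟩)
  have hNf : FilteredBy 𝒮 N := by
    have hTf := (hMf.pi n).of_equiv (ModuleCat.biproductIsoPi fun _ : Fin n => M).symm.toLinearEquiv
    refine hSf.extension (kernel.ι f).hom f.hom ((ModuleCat.mono_iff_injective _).1 inferInstance)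
        ((ModuleCat.epi_iff_surjective _).1 inferInstance)
        ((ShortComplex.ShortExact.moduleCat_exact_iff_function_exact _).1 hS.exact) hTf
  have hle : ∀ X, closureCat ![N, M] X → FilteredBy 𝒮 X := fun X hX =>
    FilteredBy.closureCat_le h𝒮 (E := ![N, M]) (fun i => by fin_cases i; exacts [hNf, hMf]) hX
  -- The bottom factor of a nonzero filtered submodule of M is S or M and maps nontrivially to M;
  -- the semibrick property makes that map bijective.
  have hsurj : ∀ X : ModuleCat.{w} R, FilteredBy 𝒮 X → ∀ g : X ⟶ M, Function.Injective g.hom →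
      g ≠ 0 → Function.Surjective g.hom := by
    intro X hX g hinj hg0
    cases hX with
    | zero _ h =>
      exact absurd (ModuleCat.hom_ext (LinearMap.ext fun x => by
        rw [Subsingleton.elim x 0, map_zero, map_zero])) hg0
    | cons S₀ _ Z i p hi hp hip hS₀ hZ =>
      have h0 : g.hom ∘ₗ i ≠ 0 := by
        intro h
        have hi0 : ∀ x : S₀, x = 0 := fun x => by
          apply hi
          apply hinj
          rw [map_zero, map_zero]
          exact LinearMap.congr_fun h x
        have hz : IsZero S₀ := (IsZero.iff_id_eq_zero _).2
          (ModuleCat.hom_ext (LinearMap.ext fun x => hi0 x))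
        rcases hS₀ with ⟨⟨e⟩⟩ | ⟨⟨e⟩⟩
        · exact hS0 (hz.of_iso e.symm)
        · exact hM0 ((IsZero.iff_id_eq_zero _).1 (hz.of_iso e.symm))
      exact Function.Surjective.of_comp (g := i) (h𝒮 S₀ M hS₀ (Or.inr ⟨Iso.refl _⟩) _ h0).2
  refine ⟨fun {Y} g _ => ⟨fun _ h => ?_, fun hg => ?_⟩⟩
  · exact hM0 (congrArg (fun f => f.hom)
      ((IsIso.inv_hom_id g).symm.trans ((congrArg (inv g ≫ ·) h).trans comp_zero)))
  -- Kernels taken among all modules lie in C(N, M), so a monomorphism there is injective.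
  · have hgm : Mono g.hom := by
      let z : (⟨kernel g.hom, (closureCat ![N, M]).prop_kernel g.hom Y.property
        (closureCat_mem ![N, M] 1)⟩ : (closureCat ![N, M]).FullSubcategory) ⟶ Y :=
        (closureCat ![N, M]).homMk (kernel.ι g.hom)
      have hz : z = 0 := by
        rw [← cancel_mono g, zero_comp]
        ext1
        exact kernel.condition g.hom
      exact Preadditive.mono_of_kernel_zero (congrArg (fun f => f.hom) hz)
    have hinj := (ModuleCat.mono_iff_injective _).1 hgm
    rw [← ObjectProperty.isIso_hom_iff, ← bijective_hom_iff_isIso]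
    exact ⟨hinj, hsurj _ (hle _ Y.property) _ hinj fun h => hg (by ext1; exact h)⟩

end ModuleSimple

/-! ### Summands of the Bongartz complement -/

section BongartzDatum

open CategoryTheory.Abelian

attribute [local instance] CategoryTheory.Abelian.hasFiniteBiproducts

variable {C : Type v} [Category.{w} C] [Abelian C] [HasExt.{w} C]

/-- The properties of the Bongartz complement `B` of `M` with respect to the generator `A` which
determine it: it is a rigid object of the perpendicular category of `M` which generates this
category, and it is an extension of an object of `add M` by a projective object. -/
structure IsBongartzDatum (A M B : C) : Prop where
  hom : Subsingleton (M ⟶ B)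
  ext : Subsingleton (Ext.{w} M B 1)
  rigid : Subsingleton (Ext.{w} B B 1)
  factor : ∃ i : A ⟶ B, ∀ X : C, Subsingleton (M ⟶ X) → Subsingleton (Ext.{w} M X 1) →
    ∀ g : A ⟶ X, ∃ h : B ⟶ X, i ≫ h = g
  approx : ∃ (T : C) (p : B ⟶ T), IsRetractSum M T ∧ Projective (kernel p)

lemma IsBongartzDatum.of_iso {A M B B' : C} (h : IsBongartzDatum A M B) (e : B' ≅ B) :
    IsBongartzDatum A M B' where
  hom := ⟨fun f g => by rw [← cancel_mono e.hom]; exact h.hom.elim _ _⟩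
  ext := ext_subsingleton_of_section (s := 𝟙 M) (r := 𝟙 M) (by simp) e.hom_inv_id h.ext
  rigid := ext_subsingleton_of_section e.hom_inv_id e.hom_inv_id h.rigid
  factor := by
    obtain ⟨i, hi⟩ := h.factor
    refine ⟨i ≫ e.inv, fun X h₁ h₂ g => ?_⟩
    obtain ⟨h, rfl⟩ := hi X h₁ h₂ g
    exact ⟨e.hom ≫ h, by simp⟩
  approx := by
    obtain ⟨T, p, hT, hp⟩ := h.approx
    refine ⟨T, e.hom ≫ p, hT, Projective.of_iso ?_ hp⟩
    exact (kernelIsIsoComp e.hom p).symm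

lemma IsBongartzDatum.of_iso_left {A M M' B : C} (h : IsBongartzDatum A M B) (e : M' ≅ M) :
    IsBongartzDatum A M' B where
  hom := ⟨fun f g => by rw [← cancel_epi e.inv]; exact h.hom.elim _ _⟩
  ext := ext_subsingleton_of_section e.hom_inv_id (s' := 𝟙 B) (r' := 𝟙 B) (by simp) h.ext
  rigid := h.rigid
  factor := by
    obtain ⟨i, hi⟩ := h.factor
    refine ⟨i, fun X h₁ h₂ => hi X ⟨fun f g => by rw [← cancel_epi e.hom]; exact h₁.elim _ _⟩ ?_⟩
    exact ext_subsingleton_of_section e.inv_hom_id (s' := 𝟙 X) (r' := 𝟙 X) (by simp) h₂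
  approx := by
    obtain ⟨T, p, ⟨n, s, r, hsr⟩, hp⟩ := h.approx
    exact ⟨T, p, ⟨n, fun j => s j ≫ e.inv, fun j => e.hom ≫ r j, by simpa using hsr⟩, hp⟩

variable [IsHereditary C]

/-- The kernel of f is projective, as a subobject of the projective kernel of B → T, and has no
nonzero map to M; hypothesis `hsin`, which encodes sincerity, makes it vanish. -/
lemma IsMinimalLeftApprox.mono_of_isBongartzDatum {A M B N T : C} (hB : IsBongartzDatum A M B)
    (hMM : Subsingleton (Ext.{w} M M 1)) {f : N ⟶ T} (hf : IsMinimalLeftApprox M f)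
    (hsin : ∀ S : C, Projective S → Subsingleton (S ⟶ M) → IsZero S)
    {s : N ⟶ B} {r : B ⟶ N} (hsr : s ≫ r = 𝟙 N) : Mono f := by
  obtain ⟨T', p, ⟨n, a, b, hab⟩, hp⟩ := hB.approx
  -- Composed with each T' → M, the map N → B → T' factors through f.
  have hsp : (kernel.ι f ≫ s) ≫ p = 0 := by
    rw [Category.assoc, ← Category.comp_id p, ← hab, Preadditive.comp_sum, Preadditive.comp_sum,
      Preadditive.comp_sum]
    refine Finset.sum_eq_zero fun j _ => ?_
    obtain ⟨h, hh⟩ := hf.factor (s ≫ p ≫ a j)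
    have : kernel.ι f ≫ s ≫ p ≫ a j = 0 := by rw [← hh]; simp
    calc _ = (kernel.ι f ≫ s ≫ p ≫ a j) ≫ b j := by simp only [Category.assoc]
      _ = 0 := by rw [this, zero_comp]
  have hs : Mono s := mono_of_mono_fac hsr
  have hproj : Projective (kernel f) := by
    have : Mono (kernel.lift p (kernel.ι f ≫ s) hsp) := by
      have h2 : kernel.lift p (kernel.ι f ≫ s) hsp ≫ kernel.ι p =
        kernel.ι f ≫ s := kernel.lift_ι _ _ _
      exact mono_of_mono_fac h2
    exact projective_of_mono (kernel.lift p (kernel.ι f ≫ s) hsp)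
  have h0 : IsZero (kernel f) := by
    refine hsin _ hproj (subsingleton_of_forall_eq 0 fun g => ?_)
    -- The image of f lies in T, so by heredity it has no extensions by M and g extends to N.
    obtain ⟨g', hg'⟩ := exists_hom_extension (shortExact_coimage f)
      (ext_one_subsingleton_of_mono (Abelian.factorThruCoimage f)
        (hf.retractSum.ext_subsingleton_left hMM)) g
    obtain ⟨h, rfl⟩ := hf.factor g'
    rw [← hg']
    simp
  exact Preadditive.mono_of_kernel_zero (h0.eq_of_src _ _)

/-- As N is perpendicular to M, the epimorphism from Aⁿ factors through Bⁿ. The embedding of N into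
T then forces Bⁿ → N to split. -/
lemma isDirectSummand_of_mono {k : Type u} [Field k] [Linear k C] {A M B N T : C}
    (hB : IsBongartzDatum A M B) (f : N ⟶ T) [Mono f] (hT : IsRetractSum M T)
    (hN : Function.Bijective (fun c : k => (c • 𝟙 N : N ⟶ N)))
    (hMN : Subsingleton (M ⟶ N)) (hMN' : Subsingleton (Ext.{w} M N 1))
    {n : ℕ} (q : (⨁ fun _ : Fin n => A) ⟶ N) [Epi q] : IsDirectSummand N B := by
  obtain ⟨i, hi⟩ := hB.factor
  choose h hh using fun j => hi N hMN hMN' (biproduct.ι (fun _ : Fin n => A) j ≫ q)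
  have hfac : biproduct.map (fun _ : Fin n => i) ≫ biproduct.desc h = q := by
    apply biproduct.hom_ext'
    intro j
    simp [hh]
  have hepi : Epi (biproduct.desc h) := epi_of_epi_fac hfac
  have hS := shortExact_kernel (biproduct.desc h)
  have hBn := isRetractSum_biproduct B n
  -- From Hom(M, N) = 0 and Ext¹(M, Bⁿ) = 0; the vanishing passes to Ext¹(T, K) and then to the
  -- subobject N of T.
  have hK : Subsingleton (Ext.{w} M (kernel (biproduct.desc h)) 1) :=
    ext_one_subsingleton_X₁_right hS (hBn.ext_subsingleton_right hB.ext) hMN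
  have hNK : Subsingleton (Ext.{w} N (kernel (biproduct.desc h)) 1) :=
    ext_one_subsingleton_of_mono f (hT.ext_subsingleton_left hK)
  obtain ⟨s, hs⟩ := exists_hom_lift hS (𝟙 N) (hNK.elim _ _)
  dsimp at s hs
  have hsum : ∑ j, (s ≫ biproduct.π (fun _ : Fin n => B) j) ≫ h j = 𝟙 N := by
    rw [← hs, biproduct.desc_eq, Preadditive.comp_sum]
    simp
  -- The n composites N → B → N are scalars with sum 1, so one of them is invertible.
  have : ∃ j, (s ≫ biproduct.π (fun _ : Fin n => B) j) ≫ h j ≠ 0 := by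
    by_contra! hcon
    rw [Finset.sum_eq_zero fun j _ => hcon j] at hsum
    exact one_ne_zero (hN.1 (a₁ := (1 : k)) (a₂ := 0) (by simp [← hsum]))
  obtain ⟨j, hj⟩ := this
  obtain ⟨c, hc⟩ := hN.2 ((s ≫ biproduct.π (fun _ : Fin n => B) j) ≫ h j)
  have hc0 : c ≠ 0 := fun h0 => hj (by rw [← hc]; simp [h0])
  refine isDirectSummand_of_section (s ≫ biproduct.π (fun _ : Fin n => B) j) (c⁻¹ • h j) ?_
  rw [Linear.comp_smul, ← hc]
  simp [smul_smul, hc0]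

end BongartzDatum

/-! ### Objects with endomorphism ring k -/

section Brick

variable {k : Type u} [Field k] {C : Type v} [Category.{w} C] [Abelian C] [Linear k C]

lemma indecomposable_of_bijective_smul {N : C}
    (hN : Function.Bijective (fun c : k => (c • 𝟙 N : N ⟶ N))) : Indecomposable N := by
  refine ⟨fun h => ?_, fun Y Z e => ?_⟩
  · exact one_ne_zero (hN.1 (a₁ := (1 : k)) (a₂ := 0) (h.eq_of_src _ _))
  -- The projector onto Y is a scalar c: Y vanishes if c = 0, and Z vanishes otherwise.
  · obtain ⟨c, hc⟩ := hN.2 (e.hom ≫ biprod.fst ≫ biprod.inl ≫ e.inv)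
    dsimp only at hc
    by_cases hc0 : c = 0
    · left
      rw [IsZero.iff_id_eq_zero]
      have := congrArg (fun t => biprod.inl ≫ e.inv ≫ t ≫ e.hom ≫ biprod.fst) hc
      simpa [hc0] using this.symm
    · right
      rw [IsZero.iff_id_eq_zero]
      have := congrArg (fun t => biprod.inr ≫ e.inv ≫ t ≫ e.hom ≫ biprod.snd) hc
      simpa [hc0] using this

-- By Happel–Ringel every nonzero endomorphism is invertible, so End N is a finite-dimensional
-- domain over an algebraically closed field.
open CategoryTheory.Abelian in
lemma bijective_smul_of_indecomposable [IsAlgClosed k] [HasExt.{w} C] [IsHereditary C] {N : C}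
    [Module.Finite k (N ⟶ N)] (hN : Indecomposable N)
    (hext : Subsingleton (Ext.{w} N N 1))
    (hfit : ∀ g : End N, IsIso (C := C) g ∨ IsNilpotent g) :
    Function.Bijective (fun c : k => (c • 𝟙 N : N ⟶ N)) := by
  have : Nontrivial (End N) := ⟨𝟙 N, 0, fun h => hN.1 ((IsZero.iff_id_eq_zero N).2 h)⟩
  have : NoZeroDivisors (End N) := ⟨fun {f g} h => by
    by_contra! hfg
    have := isIso_of_ne_zero_of_indecomposable hN hext hfit f hfg.1
    exact hfg.2 ((cancel_mono (C := C) f).1 (h.trans zero_comp.symm))⟩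
  have : IsDomain (End N) := NoZeroDivisors.to_isDomain _
  have : Module.Finite k (End N) := ‹_›
  have := IsAlgClosed.algebraMap_bijective_of_isIntegral (k := k) (K := End N)
  exact this

/-- A basis of `Hom(N, M)` gives a minimal left approximation. -/
lemma exists_isMinimalLeftApprox {N M : C} [Module.Finite k (N ⟶ M)] [HasFiniteBiproducts C]
    (hM : Function.Surjective (fun c : k => (c • 𝟙 M : M ⟶ M))) :
    ∃ (n : ℕ) (f : N ⟶ ⨁ fun _ : Fin n => M), IsMinimalLeftApprox M f := by
  let b := Module.finBasis k (N ⟶ M)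
  refine ⟨_, biproduct.lift b, isRetractSum_biproduct M _, fun g => ?_, fun h hh => ?_⟩
  · refine ⟨biproduct.desc fun j => b.repr g j • 𝟙 M, ?_⟩
    rw [biproduct.lift_desc]
    simp
  · choose c hc using fun j => hM (biproduct.ι (fun _ : Fin _ => M) j ≫ h)
    dsimp only at hc
    have hd : h = biproduct.desc fun j => c j • 𝟙 M := by
      apply biproduct.hom_ext'
      intro j
      simp [hc]
    rw [hd, biproduct.lift_desc] at hh
    have h0 := Fintype.linearIndependent_iff.1 b.linearIndependent c (by simpa using hh)
    rw [hd]
    apply biproduct.hom_ext'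
    intro j
    simp [h0]

end Brick

/-! ### The equivalence for an object with the Bongartz properties -/

section Main

open CategoryTheory.Abelian

attribute [local instance] CategoryTheory.Abelian.hasFiniteBiproducts

variable {k : Type u} [Field k] {R : Type v} [Ring R] [Algebra k R] [HasExt.{w} (ModuleCat.{w} R)]
  [IsHereditary (ModuleCat.{w} R)]

theorem summand_iff_of_isBongartzDatum [IsAlgClosed k] {A M B N : ModuleCat.{w} R}
    (hB : IsBongartzDatum A M B) (hM : IsExceptional k M)
    (hsin : ∀ S : ModuleCat.{w} R, Projective S → Subsingleton (S ⟶ M) → IsZero S)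
    [Module.Finite k (N ⟶ N)] [Module.Finite k (N ⟶ M)]
    (hfit : Indecomposable N → ∀ g : End N, IsIso (C := ModuleCat.{w} R) g ∨ IsNilpotent g)
    {n : ℕ} (q : (⨁ fun _ : Fin n => A) ⟶ N) [Epi q] :
    (Indecomposable N ∧ IsDirectSummand N B) ↔
      (IsExceptionalSequence k ![N, M] ∧
        ¬ Simple (⟨M, closureCat_mem ![N, M] 1⟩ :
          (closureCat ![N, M]).FullSubcategory)) := by
  obtain ⟨m, f, hf⟩ := exists_isMinimalLeftApprox (N := N) hM.2.2
  constructor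
  · rintro ⟨hN, hNB⟩
    obtain ⟨s, r, hsr⟩ := exists_section_of_isDirectSummand hNB
    have hs : Mono s := mono_of_mono_fac hsr
    have hNN : Subsingleton (Ext.{w} N N 1) := ext_subsingleton_of_section hsr hsr hB.rigid
    have hMN : Subsingleton (M ⟶ N) :=
      ⟨fun a b => by rw [← cancel_mono s]; exact hB.hom.elim _ _⟩
    have hMN' : Subsingleton (Ext.{w} M N 1) :=
      ext_subsingleton_of_section (s := 𝟙 M) (r := 𝟙 M) (by simp) hsr hB.ext
    have hNe : IsExceptional k N :=
      ⟨hNN, bijective_smul_of_indecomposable hN hNN (hfit hN)⟩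
    have := hf.mono_of_isBongartzDatum hB hM.1 hsin hsr
    refine ⟨⟨fun i => ?_, fun i j hij => ?_⟩, not_simple_of_mono f hf.retractSum hN.1 hMN⟩
    · fin_cases i
      · exact hNe
      · exact hM
    · fin_cases i <;> fin_cases j
      · simp at hij
      · exact ⟨hMN, hMN'⟩
      · simp at hij
      · simp at hij
  · rintro ⟨⟨hexc, hort⟩, hns⟩
    have hN : IsExceptional k N := hexc 0
    obtain ⟨hMN, hMN'⟩ : Subsingleton (M ⟶ N) ∧ Subsingleton (Ext.{w} M N 1) :=
      hort 0 1 (by simp)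
    have hmono : Mono f := by
      by_contra hnm
      have := (hf.mono_or_epi hN.2.2 hMN').resolve_left hnm
      exact hns (simple_of_epi_of_not_mono hf hnm hN.2.2 hM.2 hM.1 hMN hMN')
    exact ⟨indecomposable_of_bijective_smul hN.2,
      isDirectSummand_of_mono hB f hf.retractSum hN.2 hMN hMN' q⟩

end Main

/-! ## The path algebra is hereditary -/

noncomputable section PathAlgebraHereditary

open scoped TensorProduct

namespace PathAlgebra

variable {k : Type u} {V : Type v} [Field k] [Quiver.{w} V]

lemma ofPath_cons {x y z : V} (p : Quiver.Path x y) (a : y ⟶ z) :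
    ofPath k ⟨x, z, p.cons a⟩ = ofPath k ⟨y, z, a.toPath⟩ * ofPath k ⟨x, y, p⟩ := by
  rw [ofPath_mul_ofPath, mulPath_comp]
  rfl

lemma e_mul_ofPath {x y : V} (p : Quiver.Path x y) :
    e k y * ofPath k ⟨x, y, p⟩ = ofPath k ⟨x, y, p⟩ := by
  rw [e, ofPath_mul_ofPath, mulPath_comp, Quiver.Path.comp_nil]

lemma ofPath_mul_e {x y : V} (p : Quiver.Path x y) :
    ofPath k ⟨x, y, p⟩ * e k x = ofPath k ⟨x, y, p⟩ := by
  rw [e, ofPath_mul_ofPath, mulPath_comp, Quiver.Path.nil_comp]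

lemma ofPath_mul_e_of_ne {x y t : V} (p : Quiver.Path x y) (h : t ≠ x) :
    ofPath k ⟨x, y, p⟩ * e k t = 0 := by
  rw [e, ofPath_mul_ofPath, mulPath_of_ne _ _ h]

lemma e_mul_ofPath_of_ne {x y t : V} (p : Quiver.Path x y) (h : t ≠ y) :
    e k t * ofPath k ⟨x, y, p⟩ = 0 := by
  rw [e, ofPath_mul_ofPath, mulPath_of_ne _ _ h.symm]

lemma e_mul_e (x : V) : e k x * e k x = e k x := e_mul_ofPath _

lemma e_mul_e_of_ne {x y : V} (h : x ≠ y) : e k x * e k y = 0 := e_mul_ofPath_of_ne _ h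

variable [Fintype V]

section Derivation

variable {X Y Z : Type*} [AddCommGroup X] [AddCommGroup Y] [AddCommGroup Z]
  [Module k X] [Module k Y] [Module k Z] [Module (PathAlgebra k V) X] [Module (PathAlgebra k V) Y]
  [Module (PathAlgebra k V) Z] [IsScalarTower k (PathAlgebra k V) X]
  [IsScalarTower k (PathAlgebra k V) Y] [IsScalarTower k (PathAlgebra k V) Z]

/-- The values on paths of the derivation with prescribed values on arrows. -/
def pathDerivation (d : ∀ {y z : V}, (y ⟶ z) → (X →ₗ[k] Y)) :
    ∀ {x y : V}, Quiver.Path x y → (X →ₗ[k] Y)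
  | _, _, .nil => 0
  | x, _, .cons (b := y) (c := z) p a =>
      -- The values d a are arbitrary linear maps; the factor e_z forces the result into e_z Y, as
      -- the Leibniz rule requires.
      Algebra.lsmul k k Y (e k z) ∘ₗ d a ∘ₗ Algebra.lsmul k k X (ofPath k ⟨x, y, p⟩) +
        Algebra.lsmul k k Y (ofPath k ⟨y, z, a.toPath⟩) ∘ₗ pathDerivation d p

variable (d : ∀ {y z : V}, (y ⟶ z) → (X →ₗ[k] Y))

lemma pathDerivation_nil (x : V) : pathDerivation d (Quiver.Path.nil : Quiver.Path x x) = 0 := by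
  rw [pathDerivation]

lemma pathDerivation_cons {x y z : V} (p : Quiver.Path x y) (a : y ⟶ z) (ξ : X) :
    pathDerivation d (p.cons a) ξ = e k z • d a (ofPath k ⟨x, y, p⟩ • ξ) +
      ofPath k ⟨y, z, a.toPath⟩ • pathDerivation d p ξ := by
  rw [pathDerivation]
  rfl

lemma e_smul_pathDerivation {x y : V} (p : Quiver.Path x y) (ξ : X) :
    e k y • pathDerivation d p ξ = pathDerivation d p ξ := by
  cases p with
  | nil => rw [pathDerivation_nil, LinearMap.zero_apply, smul_zero]
  | cons p a =>
    rw [pathDerivation_cons, smul_add, ← mul_smul, ← mul_smul, e_mul_e, e_mul_ofPath]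

lemma pathDerivation_e_smul {x y : V} (p : Quiver.Path x y) (ξ : X) :
    pathDerivation d p (e k x • ξ) = pathDerivation d p ξ := by
  induction p with
  | nil => rw [pathDerivation_nil, LinearMap.zero_apply, LinearMap.zero_apply]
  | cons p a ih => rw [pathDerivation_cons, pathDerivation_cons, ← mul_smul, ofPath_mul_e, ih]

lemma pathDerivation_comp {x y z : V} (p : Quiver.Path x y) (r : Quiver.Path y z) (ξ : X) :
    pathDerivation d (p.comp r) ξ = pathDerivation d r (ofPath k ⟨x, y, p⟩ • ξ) +
      ofPath k ⟨y, z, r⟩ • pathDerivation d p ξ := by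
  induction r with
  | nil =>
    rw [Quiver.Path.comp_nil, pathDerivation_nil, LinearMap.zero_apply, zero_add]
    exact (e_smul_pathDerivation d p ξ).symm
  | cons r a ih =>
    rw [Quiver.Path.comp_cons, pathDerivation_cons, ih, pathDerivation_cons, smul_add,
      ← mulPath_comp, ← ofPath_mul_ofPath, mul_smul, ofPath_cons r, mul_smul, add_assoc]

/-- The derivation with prescribed values on arrows. -/
def derivation : PathAlgebra k V →ₗ[k] X →ₗ[k] Y :=
  Finsupp.linearCombination k fun p : QuiverPaths V => pathDerivation d p.2.2

lemma derivation_ofPath (p : QuiverPaths V) :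
    derivation d (ofPath k p) = pathDerivation d p.2.2 := by
  rw [derivation, ofPath]
  erw [Finsupp.linearCombination_single, one_smul]

lemma derivation_mul (a b : PathAlgebra k V) (ξ : X) :
    derivation d (a * b) ξ = derivation d a (b • ξ) + a • derivation d b ξ := by
  induction a using induction_on with
  | zero => simp
  | add a a' h h' =>
    rw [add_mul, map_add, LinearMap.add_apply, h, h', map_add, LinearMap.add_apply, add_smul]
    abel
  | smul s r =>
    induction b using induction_on with
    | zero => simp
    | add b b' h h' =>
      rw [mul_add, map_add, LinearMap.add_apply, h, h', map_add, LinearMap.add_apply, add_smul,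
        smul_add, map_add]
      abel
    | smul t p =>
      have key : derivation d (ofPath k r * ofPath k p) ξ =
          derivation d (ofPath k r) (ofPath k p • ξ) +
            ofPath k r • derivation d (ofPath k p) ξ := by
        obtain ⟨r₁, r₂, r⟩ := r
        obtain ⟨p₁, p₂, p⟩ := p
        rw [derivation_ofPath, derivation_ofPath]
        by_cases h : p₂ = r₁
        · subst h
          rw [ofPath_mul_ofPath, mulPath_comp, derivation_ofPath]
          exact pathDerivation_comp d p r ξ
        · rw [ofPath_mul_ofPath, mulPath_of_ne _ _ h, map_zero, ← e_smul_pathDerivation d p,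
            ← mul_smul, ofPath_mul_e_of_ne r h, zero_smul, ← pathDerivation_e_smul, ← mul_smul,
            e_mul_ofPath_of_ne p (Ne.symm h), zero_smul, map_zero]
          simp
      rw [smul_mul', mul_smul', map_smul (derivation d) s, map_smul (derivation d) t,
        map_smul (derivation d) s, map_smul (derivation d) t, LinearMap.smul_apply,
        LinearMap.smul_apply, LinearMap.smul_apply, LinearMap.smul_apply, key, smul_assoc t,
        map_smul (derivation d (ofPath k r)), smul_assoc s, smul_comm (ofPath k r) t, smul_add,
        smul_add]

/-- Derivations which vanish on the trivial paths lift along surjections. -/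
lemma exists_derivation_lift (p : Y →ₗ[PathAlgebra k V] Z) (hp : Function.Surjective p)
    (D : PathAlgebra k V →ₗ[k] X →ₗ[k] Z)
    (hD : ∀ a b ξ, D (a * b) ξ = D a (b • ξ) + a • D b ξ) (hDe : ∀ x, D (e k x) = 0) :
    ∃ δ : PathAlgebra k V →ₗ[k] X →ₗ[k] Y,
      (∀ a b ξ, δ (a * b) ξ = δ a (b • ξ) + a • δ b ξ) ∧ ∀ a ξ, p (δ a ξ) = D a ξ := by
  obtain ⟨q, hq⟩ := (p.restrictScalars k).exists_rightInverse_of_surjective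
    (LinearMap.range_eq_top.2 hp)
  have hpq : ∀ z, p (q z) = z := fun z => LinearMap.congr_fun hq z
  -- Arrows generate freely over the trivial paths, so any k-linear lifts of the values on arrows
  -- extend to a derivation.
  let d : ∀ {y z : V}, (y ⟶ z) → (X →ₗ[k] Y) := fun {y z} a => q ∘ₗ D (ofPath k ⟨y, z, a.toPath⟩)
  refine ⟨derivation d, derivation_mul d, fun a ξ => ?_⟩
  have key : ∀ {x y : V} (r : Quiver.Path x y),
      p (pathDerivation d r ξ) = D (ofPath k ⟨x, y, r⟩) ξ := by
    intro x y r
    induction r with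
    | nil =>
      have := LinearMap.congr_fun (hDe x) ξ
      rw [e] at this
      rw [pathDerivation_nil, this, LinearMap.zero_apply, LinearMap.zero_apply, map_zero]
    | @cons y z r a ih =>
      rw [pathDerivation_cons, map_add p, map_smul p, map_smul p, ih, ofPath_cons, hD]
      congr 1
      change e k z • p (q _) = _
      rw [hpq]
      have := hD (e k z) (ofPath k ⟨y, z, a.toPath⟩) (ofPath k ⟨x, y, r⟩ • ξ)
      rw [e_mul_ofPath, hDe, LinearMap.zero_apply, zero_add] at this
      exact this.symm
  induction a using induction_on with
  | zero => simp
  | add a a' h h' => rw [map_add, LinearMap.add_apply, map_add, h, h', map_add, LinearMap.add_apply]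
  | smul s r =>
    rw [map_smul, map_smul, LinearMap.smul_apply, LinearMap.smul_apply, derivation_ofPath,
      LinearMap.map_smul_of_tower, key]

end Derivation

section Resolution

variable (k V) (X : Type*) [AddCommGroup X] [Module k X] [Module (PathAlgebra k V) X]
  [IsScalarTower k (PathAlgebra k V) X]

/-- The action map `A ⊗ X ⟶ X`. -/
def actionMap : PathAlgebra k V ⊗[k] X →ₗ[PathAlgebra k V] X :=
  TensorProduct.AlgebraTensorModule.lift
    (LinearMap.toSpanSingleton (PathAlgebra k V) (X →ₗ[k] X) LinearMap.id)

@[simp]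
lemma actionMap_tmul (a : PathAlgebra k V) (ξ : X) : actionMap k V X (a ⊗ₜ ξ) = a • ξ := by
  simp [actionMap]

lemma actionMap_surjective : Function.Surjective (actionMap k V X) := fun ξ => ⟨1 ⊗ₜ ξ, by simp⟩

/-- The projection of `A ⊗ X` to the kernel of the action map. -/
def actionMapRetraction : PathAlgebra k V ⊗[k] X →ₗ[k] LinearMap.ker (actionMap k V X) :=
  LinearMap.codRestrict ((LinearMap.ker (actionMap k V X)).restrictScalars k)
    (LinearMap.id - (TensorProduct.mk k (PathAlgebra k V) X 1) ∘ₗ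
      (actionMap k V X).restrictScalars k)
    (fun w => by simp [LinearMap.mem_ker])

lemma actionMapRetraction_apply (w : PathAlgebra k V ⊗[k] X) :
    (actionMapRetraction k V X w : PathAlgebra k V ⊗[k] X) =
      w - 1 ⊗ₜ (actionMap k V X w) := rfl

/-- The retraction is only k-linear in general; on the kernel it is the identity, and there it
commutes with the algebra. -/
lemma actionMapRetraction_smul (a : PathAlgebra k V) {w : PathAlgebra k V ⊗[k] X}
    (hw : actionMap k V X w = 0) :
    actionMapRetraction k V X (a • w) = a • actionMapRetraction k V X w := by
  ext
  rw [Submodule.coe_smul, actionMapRetraction_apply, actionMapRetraction_apply, map_smul, hw]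
  simp

/-- The section `ξ ↦ ∑ e_t ⊗ e_t ξ` of the action map. -/
def actionMapSection : X →ₗ[k] PathAlgebra k V ⊗[k] X :=
  ∑ t, TensorProduct.mk k (PathAlgebra k V) X (e k t) ∘ₗ Algebra.lsmul k k X (e k t)

lemma actionMapSection_apply (ξ : X) :
    actionMapSection k V X ξ = ∑ t, e k t ⊗ₜ[k] (e k t • ξ) := by
  simp [actionMapSection]

lemma actionMap_actionMapSection (ξ : X) : actionMap k V X (actionMapSection k V X ξ) = ξ := by
  rw [actionMapSection_apply, map_sum]
  simp only [actionMap_tmul, ← mul_smul, e_mul_e]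
  rw [← Finset.sum_smul, ← one_def, one_smul]

/-- This is the advantage over the section ξ ↦ 1 ⊗ ξ: the defect a σ(ξ) − σ(aξ) vanishes on trivial
paths, as `exists_derivation_lift` demands. -/
lemma e_smul_actionMapSection (x : V) (ξ : X) :
    e k x • actionMapSection k V X ξ = actionMapSection k V X (e k x • ξ) := by
  rw [actionMapSection_apply, actionMapSection_apply, Finset.smul_sum]
  refine Finset.sum_congr rfl fun t _ => ?_
  rw [TensorProduct.smul_tmul', smul_eq_mul, ← mul_smul]
  by_cases h : x = t
  · rw [h, e_mul_e]
  · rw [e_mul_e_of_ne h, e_mul_e_of_ne (Ne.symm h)]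
    simp

/-- A splitting of a surjection p onto the kernel K is built from a derivation. The defect of the
section σ is a derivation D with values in K; a lift δ of D along p, corrected by an inner term,
gives a map on A ⊗ X that is A-linear on K and splits p there. -/
instance projective_ker_actionMap :
    Module.Projective (PathAlgebra k V) (LinearMap.ker (actionMap k V X)) := by
  set K := LinearMap.ker (actionMap k V X)
  refine Module.Projective.of_lifting_property'' fun p hp => ?_
  set E := actionMapRetraction k V X
  set σ := actionMapSection k V X
  have hσ := actionMap_actionMapSection k V X
  have hmem : ∀ (a : PathAlgebra k V) (ξ : X), actionMap k V X (a • σ ξ - σ (a • ξ)) = 0 :=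
    fun a ξ => by rw [map_sub, map_smul, hσ, hσ, sub_self]
  let D : PathAlgebra k V →ₗ[k] X →ₗ[k] K :=
    LinearMap.mk₂ k (fun a ξ => E (a • σ ξ - σ (a • ξ)))
      (fun a b ξ => by
        rw [← map_add E, add_smul, add_smul, map_add σ]; congr 1; abel)
      (fun c a ξ => by rw [← map_smul E, smul_assoc, smul_assoc, map_smul σ, smul_sub])
      (fun a ξ η => by
        rw [← map_add E, map_add σ, smul_add, smul_add, map_add σ]; congr 1; abel)
      (fun c a ξ => by
        rw [← map_smul E, map_smul σ, smul_comm a c, smul_comm a c, map_smul σ, smul_sub])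
  obtain ⟨δ, hδ, hpδ⟩ := exists_derivation_lift p hp D
    (fun a b ξ => by
      change E _ = E _ + a • E _
      rw [← actionMapRetraction_smul k V X a (hmem b ξ), ← map_add, mul_smul, mul_smul, smul_sub]
      congr 1
      abel)
    (fun x => by
      ext1 ξ
      change E _ = 0
      rw [e_smul_actionMapSection, sub_self, map_zero])
  obtain ⟨q, hq⟩ := (p.restrictScalars k).exists_rightInverse_of_surjective
    (LinearMap.range_eq_top.2 hp)
  have hpq : ∀ z, p (q z) = z := fun z => LinearMap.congr_fun hq z
  -- T lifts 1 ⊗ ξ − σ(ξ); its inner derivation passes from the section σ to ξ ↦ 1 ⊗ ξ, the one used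
  -- in the retraction E.
  let T : X →ₗ[k] (K →₀ PathAlgebra k V) :=
    q ∘ₗ E ∘ₗ (TensorProduct.mk k (PathAlgebra k V) X 1 - σ)
  let G : PathAlgebra k V ⊗[k] X →ₗ[k] (K →₀ PathAlgebra k V) :=
    TensorProduct.lift (LinearMap.mk₂ k (fun a ξ => δ a ξ + a • T ξ - T (a • ξ))
      (fun a b ξ => by
        rw [map_add, LinearMap.add_apply, add_smul, add_smul, map_add]; abel)
      (fun c a ξ => by
        rw [map_smul δ, LinearMap.smul_apply, smul_assoc, smul_assoc, map_smul T, smul_sub,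
          smul_add])
      (fun a ξ η => by rw [map_add, map_add, smul_add, smul_add, map_add]; abel)
      (fun c a ξ => by
        rw [map_smul (δ a), map_smul T, smul_comm a c, smul_comm a c, map_smul T, smul_sub,
          smul_add]))
  have hG : ∀ a ξ, G (a ⊗ₜ ξ) = δ a ξ + a • T ξ - T (a • ξ) := fun a ξ => rfl
  -- The failure of linearity depends only on the image under the action map, so it vanishes on K.
  have hGsmul : ∀ b w, G (b • w) = b • G w + δ b (actionMap k V X w) +
      b • T (actionMap k V X w) - T (b • actionMap k V X w) := by
    intro b w
    induction w using TensorProduct.induction_on with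
    | zero => simp
    | tmul a ξ =>
      rw [TensorProduct.smul_tmul', smul_eq_mul, hG, hG, hδ, actionMap_tmul, mul_smul, mul_smul,
        smul_sub, smul_add]
      abel
    | add w w' h h' =>
      rw [smul_add, map_add, h, h', map_add, map_add, map_add, map_add, smul_add, smul_add,
        smul_add, map_add]
      abel
  have hpG : ∀ w, p (G w) = E w := by
    intro w
    induction w using TensorProduct.induction_on with
    | zero => simp
    | tmul a ξ =>
      have hT : ∀ ξ, p (T ξ) = E (1 ⊗ₜ ξ - σ ξ) := fun ξ => hpq _
      have h1 : ∀ ξ, actionMap k V X (1 ⊗ₜ ξ - σ ξ) = 0 := fun ξ => by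
        rw [map_sub, hσ, actionMap_tmul, one_smul, sub_self]
      rw [hG, map_sub, map_add, map_smul, hpδ, hT, hT]
      change E _ + _ - _ = _
      rw [← actionMapRetraction_smul k V X a (h1 ξ), ← map_add, ← map_sub, smul_sub,
        TensorProduct.smul_tmul', smul_eq_mul, mul_one]
      have h2 : a • σ ξ - σ (a • ξ) + (a ⊗ₜ[k] ξ - a • σ ξ) - (1 ⊗ₜ[k] (a • ξ) - σ (a • ξ)) =
          a ⊗ₜ[k] ξ - 1 ⊗ₜ[k] (a • ξ) := by abel
      rw [h2]
      ext
      rw [actionMapRetraction_apply, actionMapRetraction_apply, map_sub, actionMap_tmul,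
        actionMap_tmul, one_smul, sub_self]
      simp
    | add w w' h h' => rw [map_add, map_add, map_add, h, h']
  refine ⟨{ toFun := fun w => G w, map_add' := fun w w' => by simp, map_smul' := fun b w => ?_ },
    ?_⟩
  · rw [Submodule.coe_smul, hGsmul, LinearMap.mem_ker.1 w.2]
    simp
  · ext1 w
    change p (G w) = w
    rw [hpG]
    ext
    rw [actionMapRetraction_apply, LinearMap.mem_ker.1 w.2]
    simp

end Resolution

-- The action map A ⊗ X → X and its kernel form a projective resolution of length one.
open scoped ModuleCat in
instance isHereditary : IsHereditary (ModuleCat.{max u v w} (PathAlgebra k V)) where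
  ext_two X Y := by
    let S : ShortComplex (ModuleCat.{max u v w} (PathAlgebra k V)) :=
      ShortComplex.mk (ModuleCat.ofHom (LinearMap.ker (actionMap k V X)).subtype)
        (ModuleCat.ofHom (actionMap k V X)) (by ext x; exact x.2)
    have hS : S.ShortExact :=
      { exact := (ShortComplex.ShortExact.moduleCat_exact_iff_function_exact _).2
          (LinearMap.exact_subtype_ker_map _)
        mono_f := (ModuleCat.mono_iff_injective _).2 Subtype.val_injective
        epi_g := (ModuleCat.epi_iff_surjective _).2 (actionMap_surjective k V X) }
    have h₁ : Projective S.X₁ := ModuleCat.projective_of_categoryTheory_projective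
      (ModuleCat.of _ (LinearMap.ker (actionMap k V X)))
    have h₂ : Projective S.X₂ := ModuleCat.projective_of_categoryTheory_projective
      (ModuleCat.of _ (PathAlgebra k V ⊗[k] X))
    refine subsingleton_of_forall_eq 0 fun x => ?_
    obtain ⟨y, rfl⟩ := Abelian.Ext.contravariant_sequence_exact₃ hS Y x
      (Abelian.Ext.eq_zero_of_projective _) (n₀ := 1) rfl
    rw [Abelian.Ext.eq_zero_of_projective y, Abelian.Ext.comp_zero]

end PathAlgebra

end PathAlgebraHereditary

/-! ## Universal extensions -/

section UniversalExtension

open CategoryTheory.Abelian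

attribute [local instance] CategoryTheory.Abelian.hasFiniteBiproducts

variable {C : Type v} [Category.{w} C] [Abelian C]

/-- The pushout of a short exact sequence along a morphism from its first term. -/
lemma shortExact_pushout {S : ShortComplex C} (hS : S.ShortExact) {A : C} (h : S.X₁ ⟶ A) :
    (ShortComplex.mk (pushout.inr S.f h) (pushout.desc S.g 0 (by simp))
      (pushout.inr_desc _ _ _)).ShortExact := by
  have := hS.mono_f
  have := hS.epi_g
  have hfac : pushout.inl S.f h ≫ pushout.desc S.g 0 (by simp) = S.g := pushout.inl_desc _ _ _
  have hepi : Epi (pushout.desc S.g (0 : A ⟶ _) (by simp) : pushout S.f h ⟶ _) :=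
    epi_of_epi_fac hfac
  refine { exact := ?_, mono_f := inferInstanceAs (Mono (pushout.inr S.f h)), epi_g := hepi }
  refine ShortComplex.exact_of_g_is_cokernel _
    (CokernelCofork.IsColimit.ofπ _ _ (fun φ hφ => hS.exact.desc (pushout.inl S.f h ≫ φ) ?_)
      (fun φ hφ => ?_) fun φ hφ m hm => ?_)
  · rw [pushout.condition_assoc, show pushout.inr S.f h ≫ φ = 0 from hφ, comp_zero]
  · apply pushout.hom_ext
    · rw [reassoc_of% hfac, hS.exact.g_desc]
    · rw [← Category.assoc, pushout.inr_desc, zero_comp]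
      exact hφ.symm
  · rw [← cancel_epi S.g, hS.exact.g_desc, ← hfac, Category.assoc]
    exact congrArg _ hm

lemma projective_biproduct {J : Type*} [Finite J] (P : J → C) [∀ j, Projective (P j)] :
    Projective (⨁ P) where
  factors f g _ := ⟨biproduct.desc fun j => Projective.factorThru (biproduct.ι P j ≫ f) g, by
    apply biproduct.hom_ext'
    intro j
    simp⟩

lemma addCat_self (M : C) : addCat M M :=
  ⟨1, isDirectSummand_of_section (biproduct.ι (fun _ : Fin 1 => M) 0)
    (biproduct.π (fun _ : Fin 1 => M) 0) (by simp)⟩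

variable [HasExt.{w} C]

/-- Every class is a pushout of a projective presentation of T. -/
lemma exists_shortExact_extClass_eq [EnoughProjectives C] {T A : C} (x : Ext.{w} T A 1) :
    ∃ (B : C) (i : A ⟶ B) (p : B ⟶ T) (w : i ≫ p = 0) (h : (ShortComplex.mk i p w).ShortExact),
      h.extClass = x := by
  have hS := shortExact_kernel (Projective.π T)
  obtain ⟨y, hy⟩ := Ext.contravariant_sequence_exact₃ hS A x
    (Ext.eq_zero_of_projective _) (add_zero 1)
  obtain ⟨h, rfl⟩ := Ext.addEquiv₀.symm.surjective y
  have hS' := shortExact_pushout hS h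
  refine ⟨_, _, _, _, hS', ?_⟩
  have := ShortComplex.ShortExact.extClass_naturality hS hS'
    { τ₁ := h
      τ₂ := pushout.inl _ _
      τ₃ := 𝟙 _
      comm₁₂ := pushout.condition.symm
      comm₂₃ := (pushout.inl_desc _ _ _).trans (Category.comp_id _).symm }
  rw [← hy]
  refine ((Ext.mk₀_id_comp _).symm.trans this.symm).trans rfl

variable {k : Type u} [Field k] [Linear k C]

/-- Take T = Mⁿ, with the extension whose components are a basis of Ext¹(M, A). Spanning gives
universality; independence and End M = k give minimality. -/
lemma exists_isMinimalUniversalExtension [EnoughProjectives C] {M A : C}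
    [Module.Finite k (Ext.{w} M A 1)]
    (hM : Function.Surjective (fun c : k => (c • 𝟙 M : M ⟶ M))) :
    ∃ (B T : C) (i : A ⟶ B) (p : B ⟶ T) (w : i ≫ p = 0)
      (hξ : (ShortComplex.mk i p w).ShortExact),
      IsMinimalUniversalExtension M (ShortComplex.mk i p w) hξ := by
  let b := Module.finBasis k (Ext.{w} M A 1)
  obtain ⟨B, i, p, w, hξ, hx⟩ := exists_shortExact_extClass_eq
    (∑ j, (Ext.mk₀ (biproduct.π (fun _ => M) j)).comp (b j) (zero_add 1))
  have hι : ∀ j, (Ext.mk₀ (biproduct.ι (fun _ => M) j)).comp hξ.extClass (zero_add 1) = b j := by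
    intro j
    rw [hx, Ext.comp_sum, Finset.sum_eq_single j]
    · rw [Ext.mk₀_comp_mk₀_assoc, biproduct.ι_π_self, Ext.mk₀_id_comp]
    · intro l _ hl
      rw [Ext.mk₀_comp_mk₀_assoc, biproduct.ι_π_ne _ hl.symm, Ext.mk₀_zero, Ext.zero_comp]
    · simp
  have hcomb : ∀ c : _ → k, (Ext.mk₀ (∑ j, c j • biproduct.ι (fun _ => M) j)).comp hξ.extClass
      (zero_add 1) = ∑ j, c j • b j := by
    intro c
    rw [Ext.mk₀_sum, Ext.sum_comp]
    refine Finset.sum_congr rfl fun j _ => ?_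
    rw [Ext.mk₀_smul, Ext.smul_comp, hι]
  refine ⟨B, _, i, p, w, hξ, addCat_biproduct M _, fun T' hT' y => ?_, fun f hf => ?_⟩
  · obtain ⟨n, s, r, hsr⟩ := isRetractSum_of_addCat hT'
    refine ⟨∑ l, s l ≫ ∑ j, b.repr ((Ext.mk₀ (r l)).comp y (zero_add 1)) j •
      biproduct.ι (fun _ => M) j, ?_⟩
    change (Ext.mk₀ _).comp hξ.extClass _ = y
    conv_rhs => rw [← Ext.mk₀_id_comp y, ← hsr, Ext.mk₀_sum, Ext.sum_comp]
    rw [Ext.mk₀_sum, Ext.sum_comp]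
    refine Finset.sum_congr rfl fun l _ => ?_
    rw [← Ext.mk₀_comp_mk₀_assoc, ← Ext.mk₀_comp_mk₀_assoc, hcomb, b.sum_repr]
  -- Pulling back the class is injective on Hom(M, Mⁿ), so an endomorphism fixing it must be the
  -- identity.
  · have hinj : ∀ ψ : M ⟶ ⨁ fun _ => M,
        (Ext.mk₀ ψ).comp hξ.extClass (zero_add 1) = 0 → ψ = 0 := by
      intro ψ hψ
      choose c hc using fun j => hM (ψ ≫ biproduct.π (fun _ => M) j)
      dsimp only at hc
      have hψ' : ψ = ∑ j, c j • biproduct.ι (fun _ => M) j := by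
        rw [← Category.comp_id ψ, ← biproduct.total, Preadditive.comp_sum]
        refine Finset.sum_congr rfl fun j _ => ?_
        rw [← Category.assoc, ← hc]
        simp
      rw [hψ', hcomb] at hψ
      have h0 := Fintype.linearIndependent_iff.1 b.linearIndependent c hψ
      rw [hψ']
      exact Finset.sum_eq_zero fun j _ => by rw [h0, zero_smul]
    have h1 : f = 𝟙 _ := by
      apply biproduct.hom_ext'
      intro j
      rw [← sub_eq_zero]
      apply hinj
      rw [sub_eq_add_neg, Ext.mk₀_add, Ext.mk₀_neg, Ext.add_comp, Ext.neg_comp,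
        ← Ext.mk₀_comp_mk₀_assoc]
      erw [hf]
      rw [Category.comp_id, add_neg_cancel]
    rw [h1]
    infer_instance

/-- Universality kills Ext¹(M, B) and minimality kills Hom(M, B); the remaining properties follow
from the sequence 0 → A → B → T → 0 with A projective. -/
lemma IsMinimalUniversalExtension.isBongartzDatum [IsHereditary C] {M : C}
    (hM : IsExceptional k M) {ξ : ShortComplex C} {hξ : ξ.ShortExact} [Projective ξ.X₁]
    (hMA : Subsingleton (M ⟶ ξ.X₁)) (h : IsMinimalUniversalExtension M ξ hξ) :
    IsBongartzDatum ξ.X₁ M ξ.X₂ := by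
  have hT := isRetractSum_of_addCat h.mem_add
  -- A nonzero φ splits, as End M = k. If it annihilated ξ, then 1 minus the projector onto this
  -- copy of M would fix ξ without being mono.
  have hinj : ∀ φ : M ⟶ ξ.X₃, (Ext.mk₀ φ).comp hξ.extClass (zero_add 1) = 0 → φ = 0 := by
    intro φ hφ
    by_contra hφ0
    have : ∃ s : ξ.X₃ ⟶ M, φ ≫ s ≠ 0 := by
      by_contra! hcon
      exact hφ0 (hT.eq_zero_of_comp hcon)
    obtain ⟨s, hs⟩ := this
    obtain ⟨c, hc⟩ := hM.2.2 (φ ≫ s)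
    dsimp only at hc
    have hc0 : c ≠ 0 := fun h0 => hs (by rw [← hc, h0, zero_smul])
    have hφs : φ ≫ (c⁻¹ • s) = 𝟙 M := by
      rw [Linear.comp_smul, ← hc, smul_smul, inv_mul_cancel₀ hc0, one_smul]
    have hiso := h.minimal (𝟙 _ - (c⁻¹ • s) ≫ φ) (by
      rw [sub_eq_add_neg, Ext.mk₀_add, Ext.mk₀_neg, Ext.add_comp, Ext.neg_comp, Ext.mk₀_id_comp,
        ← Ext.mk₀_comp_mk₀_assoc, hφ, Ext.comp_zero, neg_zero, add_zero])
    refine hφ0 ?_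
    rw [← cancel_mono (𝟙 _ - (c⁻¹ • s) ≫ φ), Preadditive.comp_sub, reassoc_of% hφs]
    simp
  have hext : Subsingleton (Ext.{w} M ξ.X₂ 1) := by
    refine subsingleton_of_forall_eq 0 fun x => ?_
    have := hT.ext_subsingleton_right hM.1
    obtain ⟨y, rfl⟩ := Ext.covariant_sequence_exact₂ M hξ x (Subsingleton.elim _ _)
    -- Every class in Ext¹(M, A) is a pullback of ξ, so it dies in Ext¹(M, B).
    obtain ⟨φ, rfl⟩ := h.universal M (addCat_self M) y
    dsimp only
    rw [Ext.comp_assoc_of_third_deg_zero, hξ.extClass_comp, Ext.comp_zero]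
  exact
  { hom := by
      refine subsingleton_of_forall_eq 0 fun g => ?_
      have h0 : g ≫ ξ.g = 0 := hinj _ (by
        rw [← Ext.mk₀_comp_mk₀_assoc, hξ.comp_extClass, Ext.comp_zero])
      have := hξ.mono_f
      rw [← hξ.exact.lift_f g h0, hMA.elim (hξ.exact.lift g h0) 0, zero_comp]
    ext := hext
    rigid := ext_one_subsingleton_X₂_left hξ (HasProjectiveDimensionLT.subsingleton _ 1 1 le_rfl _)
      (hT.ext_subsingleton_left hext)
    factor := ⟨ξ.f, fun X _ hX g => exists_hom_extension hξ (hT.ext_subsingleton_left hX) g⟩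
    approx := ⟨ξ.X₃, ξ.g, hT, by
      have := hξ.mono_f
      have e : ξ.X₁ ≅ kernel ξ.g :=
        hξ.exact.fIsKernel.conePointUniqueUpToIso (limit.isLimit (parallelPair ξ.g 0))
      exact Projective.of_iso e inferInstance⟩ }

/-- The image of φ is a subobject of a projective, hence projective, and splits off M; as End M = k,
it is all of M. -/
lemma projective_of_hom_ne_zero [IsHereditary C] {M P : C} [Projective P]
    (hM : Function.Surjective (fun c : k => (c • 𝟙 M : M ⟶ M))) {φ : M ⟶ P} (hφ : φ ≠ 0) :
    Projective M := by
  have := projective_of_mono (Abelian.factorThruCoimage φ)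
  have hs := Projective.factorThru_comp (𝟙 _) (Abelian.coimage.π φ)
  set s := Projective.factorThru (𝟙 _) (Abelian.coimage.π φ)
  obtain ⟨c, hc⟩ := hM (Abelian.coimage.π φ ≫ s)
  dsimp only at hc
  have hc0 : c ≠ 0 := by
    rintro rfl
    apply hφ
    rw [← Abelian.coimage.fac φ, ← Category.id_comp (Abelian.factorThruCoimage φ), ← hs]
    have : s = 0 := by
      rw [← cancel_epi (Abelian.coimage.π φ), ← hc, zero_smul, comp_zero]
    rw [this, zero_comp, zero_comp, comp_zero]
  have hmono : Mono (Abelian.coimage.π φ) := by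
    have : IsIso (Abelian.coimage.π φ ≫ s) :=
      ⟨c⁻¹ • 𝟙 M, by simp [← hc, smul_smul, hc0], by simp [← hc, smul_smul, hc0]⟩
    exact mono_of_mono _ s
  exact projective_of_mono (Abelian.coimage.π φ)

end UniversalExtension

/-! ## Path algebras of quivers without oriented cycles -/

section Acyclic

open scoped ModuleCat

namespace Quiver.NoOrientedCycles

variable {V : Type v} [Quiver.{w} V] (hV : Quiver.NoOrientedCycles V)

include hV

lemma eq_of_path {x y : V} (p : Quiver.Path x y) (q : Quiver.Path y x) : x = y := by
  have := hV x (p.comp q)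
  have h := congrArg Quiver.Path.length this
  rw [Quiver.Path.length_comp, Quiver.Path.length_nil] at h
  exact Quiver.Path.eq_of_length_zero p (by omega)

lemma wellFounded [Finite V] :
    WellFounded fun x y : V => x ≠ y ∧ Nonempty (Quiver.Path x y) := by
  have : IsTrans V fun x y : V => x ≠ y ∧ Nonempty (Quiver.Path x y) :=
    ⟨fun x y z ⟨h, ⟨p⟩⟩ ⟨h', ⟨q⟩⟩ => ⟨by
      rintro rfl
      exact h (hV.eq_of_path p q), ⟨p.comp q⟩⟩⟩
  have : Std.Irrefl fun x y : V => x ≠ y ∧ Nonempty (Quiver.Path x y) := ⟨fun x h => h.1 rfl⟩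
  exact Finite.wellFounded_of_trans_of_irrefl _

/-- Induction on the end point: a nontrivial path is determined by its last arrow, which is not a
loop, and the path before it. -/
lemma finite_path [Finite V] [∀ x y : V, Finite (x ⟶ y)] (x y : V) :
    Finite (Quiver.Path x y) := by
  induction y using hV.wellFounded.induction with
  | _ y ih =>
    have h : ∀ z : {z : V // z ≠ y ∧ Nonempty (Quiver.Path z y)}, Finite (Quiver.Path x z) :=
      fun z => ih z z.2
    refine Set.finite_univ_iff.1 ?_
    have hs : (Set.univ : Set (Quiver.Path x y)) ⊆
        {p | p.length = 0} ∪ Set.range (fun s : (Σ z : {z : V // z ≠ y ∧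
          Nonempty (Quiver.Path z y)}, Quiver.Path x z × ((z : V) ⟶ y)) => s.2.1.cons s.2.2) := by
      intro p _
      cases p with
      | nil => exact Or.inl rfl
      | @cons z _ p a =>
        refine Or.inr ⟨⟨⟨z, ?_, ⟨a.toPath⟩⟩, p, a⟩, rfl⟩
        rintro rfl
        have := congrArg Quiver.Path.length (hV _ a.toPath)
        simp at this
    refine (Set.Finite.union ?_ (Set.finite_range _)).subset hs
    refine Set.Subsingleton.finite fun p hp q hq => ?_
    obtain rfl := Quiver.Path.eq_of_length_zero p hp
    exact (hV _ p).trans (hV _ q).symm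

end Quiver.NoOrientedCycles

namespace PathAlgebra

variable {k : Type u} {V : Type v} [Field k] [Quiver.{w} V] [Fintype V]

lemma finite_of_noOrientedCycles (hV : Quiver.NoOrientedCycles V) [∀ x y : V, Finite (x ⟶ y)] :
    Module.Finite k (PathAlgebra k V) := by
  have := hV.finite_path
  have : Finite (QuiverPaths V) := inferInstance
  exact inferInstanceAs (Module.Finite k (QuiverPaths V →₀ k))

lemma sum_e_smul {X : Type*} [AddCommGroup X] [Module (PathAlgebra k V) X] (x : X) :
    ∑ t : V, e k t • x = x := by
  rw [← Finset.sum_smul, ← one_def (k := k) (V := V), one_smul]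

/-- e_t A e_y is spanned by the paths from y to t. -/
lemma e_mul_mul_e_of_isEmpty {t y : V} (h : IsEmpty (Quiver.Path y t)) (a : PathAlgebra k V) :
    e k t * a * e k y = 0 := by
  induction a using induction_on with
  | zero => simp
  | add a b ha hb => rw [mul_add, add_mul, ha, hb, add_zero]
  | smul c p =>
    obtain ⟨x, z, p⟩ := p
    rw [mul_smul', smul_mul']
    by_cases hz : t = z
    · subst hz
      rw [e_mul_ofPath, ofPath_mul_e_of_ne, smul_zero]
      rintro rfl
      exact h.elim p
    · rw [e_mul_ofPath_of_ne p hz, zero_mul, smul_zero]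

lemma exists_e_mul_mul_e (hV : Quiver.NoOrientedCycles V) (t : V) (a : PathAlgebra k V) :
    ∃ c : k, e k t * a * e k t = c • e k t := by
  induction a using induction_on with
  | zero => exact ⟨0, by simp⟩
  | add a b ha hb =>
    obtain ⟨c, hc⟩ := ha
    obtain ⟨d, hd⟩ := hb
    exact ⟨c + d, by rw [mul_add, add_mul, hc, hd, add_smul]⟩
  | smul c p =>
    obtain ⟨x, z, p⟩ := p
    rw [mul_smul', smul_mul']
    by_cases hz : t = z
    · subst hz
      by_cases hx : t = x
      · subst hx
        refine ⟨c, ?_⟩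
        rw [hV _ p]
        exact congrArg _ ((congrArg (· * e k t) (e_mul_e t)).trans (e_mul_e t))
      · exact ⟨0, by rw [e_mul_ofPath, ofPath_mul_e_of_ne p hx, smul_zero, zero_smul]⟩
    · exact ⟨0, by rw [e_mul_ofPath_of_ne p hz, zero_mul, smul_zero, zero_smul]⟩

/-- A projective module without nonzero morphisms to a sincere module vanishes. -/
lemma subsingleton_of_projective_of_sincere (hV : Quiver.NoOrientedCycles V) {S M : Type*}
    [AddCommGroup S] [AddCommGroup M] [Module (PathAlgebra k V) S] [Module (PathAlgebra k V) M]
    [Module.Projective (PathAlgebra k V) S] (hM : ∀ t : V, ∃ m : M, e k t • m ≠ 0)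
    (hSM : ∀ f : S →ₗ[PathAlgebra k V] M, f = 0) : Subsingleton S := by
  obtain ⟨s, hs⟩ := (Module.projective_def (R := PathAlgebra k V) (P := S)).1 inferInstance
  have key : ∀ (t : V) (x : S), e k t • x = 0 := by
    intro t
    -- Induction along paths into t. Writing S as a summand of a free module, e_t x is a combination
    -- of elements i with coefficients a in e_t A, and only the part a e_t, a multiple of e_t, can
    -- contribute.
    induction t using hV.wellFounded.induction with
    | _ t ih =>
      intro x
      obtain ⟨m, hm⟩ := hM t
      rw [← hs (e k t • x), Finsupp.linearCombination_apply]
      refine Finset.sum_eq_zero fun i _ => ?_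
      set a := s (e k t • x) i with ha
      have hta : e k t * a = a := by
        rw [ha, map_smul, Finsupp.smul_apply, smul_eq_mul, ← mul_assoc, e_mul_e]
      -- A coordinate of the embedding followed by 1 ↦ e_t m is a map S → M, hence zero; this
      -- excludes a nonzero multiple of e_t.
      have h0 : a • e k t • m = 0 := by
        have := LinearMap.congr_fun (hSM ((LinearMap.toSpanSingleton (PathAlgebra k V) M
          (e k t • m)) ∘ₗ Finsupp.lapply i ∘ₗ s)) (e k t • x)
        exact this
      have hc : a * e k t = 0 := by
        obtain ⟨c, hc⟩ := exists_e_mul_mul_e hV t a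
        rw [hta] at hc
        by_cases hc0 : c = 0
        · rw [hc, hc0, zero_smul]
        · refine absurd ?_ hm
          have : (c⁻¹ • (1 : PathAlgebra k V)) * (a * e k t) = e k t := by
            rw [hc, smul_mul', one_mul, smul_smul, inv_mul_cancel₀ hc0, one_smul]
          rw [← this, mul_smul, mul_smul, h0, smul_zero]
      change a • i = 0
      rw [← sum_e_smul (k := k) (V := V) i, Finset.smul_sum]
      refine Finset.sum_eq_zero fun y _ => ?_
      by_cases hy : y = t
      · rw [hy, ← mul_smul, hc, zero_smul]
      · by_cases hp : Nonempty (Quiver.Path y t)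
        · rw [ih y ⟨hy, hp⟩, smul_zero]
        · rw [← mul_smul, ← hta, e_mul_mul_e_of_isEmpty (not_nonempty_iff.1 hp), zero_smul]
  refine subsingleton_of_forall_eq 0 fun x => ?_
  rw [← sum_e_smul (k := k) (V := V) x]
  exact Finset.sum_eq_zero fun t _ => key t x

end PathAlgebra

end Acyclic

noncomputable section BongartzComplement

attribute [local instance] CategoryTheory.Abelian.hasFiniteBiproducts

open scoped ModuleCat ZeroObject

/-! ### Finiteness and Fitting's lemma for finite-dimensional modules -/

section FiniteDimensional

variable {k : Type u} [Field k] {R : Type v} [Ring R] [Algebra k R]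

lemma finite_hom (X Y : ModuleCat.{w} R) [Module.Finite k X] [Module.Finite k Y] :
    Module.Finite k (X ⟶ Y) := by
  let f : (X ⟶ Y) →ₗ[k] (X →ₗ[k] Y) :=
    { toFun := fun g => g.hom.restrictScalars k
      map_add' := fun _ _ => rfl
      map_smul' := fun _ _ => rfl }
  refine Module.Finite.of_injective f fun g g' h => ?_
  ext x
  exact LinearMap.congr_fun h x

lemma exists_epi_of_finite [Small.{w} R] (A : ModuleCat.{w} R) (e : A ≃ₗ[R] R)
    (X : ModuleCat.{w} R) [Module.Finite k X] :
    ∃ (n : ℕ) (q : (⨁ fun _ : Fin n => A) ⟶ X), Epi q := by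
  have : Module.Finite R X := Module.Finite.of_restrictScalars_finite k R X
  obtain ⟨n, f, hf⟩ := Module.Finite.exists_fin' R X
  refine ⟨n, (ModuleCat.biproductIsoPi fun _ : Fin n => A).hom ≫
    ModuleCat.ofHom (f ∘ₗ (LinearEquiv.piCongrRight fun _ : Fin n => e).toLinearMap), ?_⟩
  have : Epi (ModuleCat.ofHom (f ∘ₗ
      (LinearEquiv.piCongrRight fun _ : Fin n => e).toLinearMap)) :=
    (ModuleCat.epi_iff_surjective _).2
      (hf.comp (LinearEquiv.piCongrRight fun _ : Fin n => e).surjective)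
  exact epi_comp _ _

lemma finite_biproduct (X : ModuleCat.{w} R) [Module.Finite k X] (n : ℕ) :
    Module.Finite k (⨁ fun _ : Fin n => X : ModuleCat.{w} R) := by
  have : Module.Finite k (Fin n → X) := inferInstance
  exact Module.Finite.equiv
    ((ModuleCat.biproductIsoPi fun _ : Fin n => X).symm.toLinearEquiv.restrictScalars k)

lemma finite_kernel {X Y : ModuleCat.{w} R} (f : X ⟶ Y) [Module.Finite k X] :
    Module.Finite k (kernel f : ModuleCat.{w} R) :=
  Module.Finite.of_injective ((kernel.ι f).hom.restrictScalars k)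
    ((ModuleCat.mono_iff_injective (kernel.ι f)).1 inferInstance)

open CategoryTheory.Abelian in
lemma finite_ext_one [HasExt.{w} (ModuleCat.{w} R)] [Small.{w} R] (A : ModuleCat.{w} R)
    (e : A ≃ₗ[R] R) [Module.Finite k A] (X Y : ModuleCat.{w} R) [Module.Finite k X]
    [Module.Finite k Y] : Module.Finite k (Ext.{w} X Y 1) := by
  obtain ⟨n, q, hq⟩ := exists_epi_of_finite (k := k) A e X
  have : Projective A := by
    have : Module.Projective R A := Module.Projective.of_equiv' e.symm
    exact ModuleCat.projective_of_categoryTheory_projective A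
  have := finite_biproduct (k := k) A n
  have := finite_kernel (k := k) q
  have := finite_hom (k := k) (kernel q) Y
  have hS := shortExact_kernel q
  have hP : Projective (⨁ fun _ : Fin n => A) := projective_biproduct _
  let f : (kernel q ⟶ Y) →ₗ[k] Ext.{w} X Y 1 :=
    { toFun := fun g => hS.extClass.comp (Ext.mk₀ g) (add_zero 1)
      map_add' := fun g g' => by rw [Ext.mk₀_add, Ext.comp_add]
      map_smul' := fun c g => by rw [Ext.mk₀_smul, Ext.comp_smul]; rfl }
  refine Module.Finite.of_surjective f fun x => ?_
  obtain ⟨y, hy⟩ := Ext.contravariant_sequence_exact₃ hS Y x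
    (Ext.eq_zero_of_projective (P := ⨁ fun _ : Fin n => A) _) (add_zero 1)
  obtain ⟨h, rfl⟩ := Ext.addEquiv₀.symm.surjective y
  exact ⟨h, hy⟩

/-- Fitting: N is the direct sum of the kernel and the image of a high power of g. -/
lemma isIso_or_isNilpotent (N : ModuleCat.{w} R) [Module.Finite k N] (hN : Indecomposable N)
    (g : End N) : IsIso (C := ModuleCat.{w} R) g ∨ IsNilpotent g := by
  have : IsNoetherian k N := inferInstance
  have : IsArtinian k N := inferInstance
  have : IsNoetherian R N := isNoetherian_of_tower k inferInstance
  have : IsArtinian R N := isArtinian_of_tower k inferInstance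
  let φ : Module.End R N := g.hom
  obtain ⟨n, hn, hn0⟩ := ((LinearMap.eventually_isCompl_ker_pow_range_pow φ).and
    (Filter.eventually_ge_atTop 1)).exists
  have e : N ≅ ModuleCat.of R (LinearMap.ker (φ ^ n)) ⊞ ModuleCat.of R (LinearMap.range (φ ^ n)) :=
    (Submodule.prodEquivOfIsCompl _ _ hn).symm.toModuleIso ≪≫
      (ModuleCat.biprodIsoProd (ModuleCat.of R (LinearMap.ker (φ ^ n)))
        (ModuleCat.of R (LinearMap.range (φ ^ n)))).symm
  rcases hN.2 _ _ e with h | h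
  · left
    have hker : LinearMap.ker (φ ^ n) = ⊥ := by
      rw [Submodule.eq_bot_iff]
      intro x hx
      have := ModuleCat.subsingleton_of_isZero h
      exact congrArg Subtype.val (Subsingleton.elim (α := LinearMap.ker (φ ^ n)) ⟨x, hx⟩ 0)
    have hinj : Function.Injective φ := by
      have h1 : Function.Injective (φ ^ n) := LinearMap.ker_eq_bot.1 hker
      obtain ⟨m, rfl⟩ := Nat.exists_eq_add_of_le' hn0
      rw [pow_succ] at h1
      exact Function.Injective.of_comp (f := (φ ^ m : Module.End R N)) h1
    rw [← bijective_hom_iff_isIso]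
    exact ⟨hinj, IsArtinian.surjective_of_injective_endomorphism φ hinj⟩
  · right
    refine ⟨n, ?_⟩
    have h0 : φ ^ n = 0 := by
      rw [← LinearMap.range_eq_bot, Submodule.eq_bot_iff]
      intro x hx
      have := ModuleCat.subsingleton_of_isZero h
      exact congrArg Subtype.val (Subsingleton.elim (α := LinearMap.range (φ ^ n)) ⟨x, hx⟩ 0)
    apply (ModuleCat.endRingEquiv N).injective
    rw [map_pow, map_zero]
    exact h0

end FiniteDimensional

lemma biproduct_lift_comp_desc_eq_sum {C : Type*} [Category* C] [Preadditive C] {J : Type*} [Fintype J]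
    {f : J → C} [HasBiproduct f] {T U : C} (g : ∀ j, T ⟶ f j) (h : ∀ j, f j ⟶ U) :
    biproduct.lift g ≫ biproduct.desc h = ∑ j, g j ≫ h j := by
  rw [← Category.comp_id (biproduct.lift g), ← IsBilimit.total (biproduct.isBilimit f),
    Preadditive.comp_sum, Preadditive.sum_comp]
  refine Finset.sum_congr rfl fun j _ => ?_
  simp

/-! ### Indecomposable projectives and the Bongartz complement over the path algebra -/

namespace PathAlgebra

variable {k : Type u} {V : Type v} [Field k] [Quiver.{w} V] [Fintype V]

variable (k) in
/-- The generator `e_t` of `P_t`. -/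
def projGen (t : V) : projModule k t :=
  ⟨e k t, Submodule.mem_span_singleton_self _⟩

lemma e_smul_projGen (t : V) : e k t • projGen k t = projGen k t :=
  Subtype.ext (e_mul_e t)

lemma projModule_hom_ext {t : V} {X : ModuleCat.{max u v w} (PathAlgebra k V)}
    {f g : projModule k t ⟶ X} (h : f (projGen k t) = g (projGen k t)) : f = g := by
  ext ⟨x, hx⟩
  obtain ⟨a, rfl⟩ := Submodule.mem_span_singleton.1 hx
  have h1 : (⟨a • e k t, hx⟩ : projModule k t) = a • projGen k t := rfl
  rw [h1]
  erw [map_smul f.hom a, map_smul g.hom a]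
  exact congrArg _ h

variable (k) in
/-- The inclusion of `P_t` in the regular module. -/
def projInclusion (t : V) : projModule k t ⟶ regularModule k V :=
  ModuleCat.ofHom (Submodule.subtype _)

variable (k) in
/-- The projection `a ↦ a e_t` of the regular module to `P_t`. -/
def projProjection (t : V) : regularModule k V ⟶ projModule k t :=
  ModuleCat.ofHom (LinearMap.toSpanSingleton (PathAlgebra k V) (projModule k t) (projGen k t))

lemma projInclusion_projProjection (t : V) :
    projInclusion k t ≫ projProjection k t = 𝟙 _ := by
  apply projModule_hom_ext
  exact e_smul_projGen t

lemma sum_projProjection_projInclusion :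
    ∑ t : V, projProjection k t ≫ projInclusion k t = 𝟙 (regularModule k V) := by
  refine ModuleCat.hom_ext (LinearMap.ext fun x => ?_)
  rw [ModuleCat.hom_sum, LinearMap.sum_apply]
  let y : PathAlgebra k V := x
  change ∑ t : V, y * e k t = y
  rw [← Finset.mul_sum, ← one_def, mul_one]

instance : Projective (regularModule k V) :=
  ModuleCat.projective_of_categoryTheory_projective
    (ModuleCat.of (PathAlgebra k V) (PathAlgebra k V))

instance (t : V) : Projective (projModule k t) :=
  Retract.projective ⟨projInclusion k t, projProjection k t, projInclusion_projProjection t⟩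

lemma e_smul_apply_projGen {t : V} {X : ModuleCat.{max u v w} (PathAlgebra k V)}
    (f : projModule k t ⟶ X) : e k t • f (projGen k t) = f (projGen k t) := by
  conv_rhs => rw [← e_smul_projGen t]
  exact (map_smul f.hom _ _).symm

lemma exists_smul_id_eq (hV : Quiver.NoOrientedCycles V) (t : V)
    (f : projModule k t ⟶ projModule k t) : ∃ c : k, c • 𝟙 _ = f := by
  have h := e_smul_apply_projGen f
  obtain ⟨a, ha⟩ := Submodule.mem_span_singleton.1 (f (projGen k t)).2
  obtain ⟨c, hc⟩ := exists_e_mul_mul_e hV t a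
  refine ⟨c, projModule_hom_ext ?_⟩
  refine Subtype.ext ?_
  have h2 : (f (projGen k t)).1 = c • e k t := by
    rw [← hc, mul_assoc]
    refine (congrArg Subtype.val h).symm.trans ?_
    change e k t * (f (projGen k t)).1 = _
    rw [← ha]
    rfl
  rw [h2]
  change (c • projGen k t).1 = _
  rw [← algebraMap_smul (PathAlgebra k V) c]
  change algebraMap k (PathAlgebra k V) c * e k t = _
  rw [← Algebra.smul_def]

lemma nonempty_path_of_isSincere {s : V} (h : IsSincere (projModule k s)) (t : V) :
    Nonempty (Quiver.Path s t) := by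
  by_contra hp
  obtain ⟨⟨m, hm⟩, h0⟩ := h t
  obtain ⟨a, rfl⟩ := Submodule.mem_span_singleton.1 hm
  refine h0 (Subtype.ext ?_)
  change e k t * (a * e k s) = 0
  rw [← mul_assoc, e_mul_mul_e_of_isEmpty (not_nonempty_iff.1 hp)]

/-- Hom(P_s, P_t) is spanned by the paths from t to s. Sincerity of P_s gives a path from s to t, so
one back would close an oriented cycle. -/
lemma subsingleton_projModule_hom (hV : Quiver.NoOrientedCycles V) {s t : V} (hst : t ≠ s)
    (h : IsSincere (projModule k s)) : Subsingleton (projModule k s ⟶ projModule k t) := by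
  refine subsingleton_of_forall_eq 0 fun f => projModule_hom_ext ?_
  obtain ⟨a, ha⟩ := Submodule.mem_span_singleton.1 (f (projGen k s)).2
  obtain ⟨p⟩ := nonempty_path_of_isSincere h t
  have hE : IsEmpty (Quiver.Path t s) := ⟨fun q => hst (hV.eq_of_path q p)⟩
  rw [← e_smul_apply_projGen f]
  refine Subtype.ext ?_
  change e k s * (f (projGen k s)).1 = 0
  rw [← ha]
  change e k s * (a * e k t) = 0
  rw [← mul_assoc, e_mul_mul_e_of_isEmpty hE]

lemma isBongartzDatum_biproduct (hV : Quiver.NoOrientedCycles V) {s : V}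
    (h : IsSincere (projModule k s)) :
    IsBongartzDatum (regularModule k V) (projModule k s)
      (⨁ fun t : {t : V // t ≠ s} => projModule k (t : V)) := by
  classical
  have hP : Projective (⨁ fun t : {t : V // t ≠ s} => projModule k (t : V)) :=
    projective_biproduct _
  refine ⟨?_, HasProjectiveDimensionLT.subsingleton _ 1 1 le_rfl _,
    HasProjectiveDimensionLT.subsingleton _ 1 1 le_rfl _, ?_, ?_⟩
  · refine subsingleton_of_forall_eq 0 fun f => biproduct.hom_ext _ _ fun t => ?_
    exact (subsingleton_projModule_hom hV t.2 h).elim _ _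
  · refine ⟨biproduct.lift fun t => projProjection k (t : V), fun X hX _ g =>
      ⟨biproduct.desc fun t => projInclusion k (t : V) ≫ g, ?_⟩⟩
    have hld : biproduct.lift (fun t : {t : V // t ≠ s} => projProjection k (t : V)) ≫
        biproduct.desc (fun t : {t : V // t ≠ s} => projInclusion k (t : V) ≫ g) =
          ∑ t : {t : V // t ≠ s}, projProjection k (t : V) ≫ projInclusion k (t : V) ≫ g :=
      biproduct_lift_comp_desc_eq_sum _ _
    refine hld.trans ?_
    -- The summand at s drops out because Hom(P_s, X) = 0.
    conv_rhs => rw [← Category.id_comp g, ← sum_projProjection_projInclusion,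
      Preadditive.sum_comp, ← Finset.sum_erase (a := s) _ (by
        rw [Category.assoc, hX.elim (projInclusion k s ≫ g) 0, comp_zero])]
    rw [← Finset.sum_subtype (Finset.univ.erase s) (fun t => by simp)
      (fun t => projProjection k t ≫ projInclusion k t ≫ g)]
    exact Finset.sum_congr rfl fun t _ => (Category.assoc _ _ _).symm
  -- Here T = 0, so the kernel is the projective module itself.
  · exact ⟨0, 0, ⟨0, fun j => j.elim0, fun j => j.elim0, (isZero_zero _).eq_of_src _ _⟩,
      Projective.of_iso (kernelZeroIsoSource).symm hP⟩

/-- The identity of M is a sum of maps through the modules P_t; one summand is nonzero, and since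
both endomorphism rings consist of scalars it gives an isomorphism. -/
lemma exists_iso_projModule (hV : Quiver.NoOrientedCycles V)
    (M : ModuleCat.{max u v w} (PathAlgebra k V)) [Module.Finite k M] [Projective M]
    (hM : Function.Bijective (fun c : k => (c • 𝟙 M : M ⟶ M))) :
    ∃ s : V, Nonempty (M ≅ projModule k s) := by
  have h1 : 𝟙 M ≠ 0 := fun h => one_ne_zero (hM.1 (a₁ := (1 : k)) (a₂ := 0) (by simp [h]))
  obtain ⟨n, q, hq⟩ := exists_epi_of_finite (k := k) (regularModule k V) (LinearEquiv.refl _ _) M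
  have hs := Projective.factorThru_comp (𝟙 M) q
  set r := Projective.factorThru (𝟙 M) q
  have hsum : ∑ j, ∑ t, (r ≫ biproduct.π (fun _ : Fin n => regularModule k V) j ≫
      projProjection k t) ≫ projInclusion k t ≫
        biproduct.ι (fun _ : Fin n => regularModule k V) j ≫ q = 𝟙 M := by
    rw [← hs]
    conv_rhs => rw [← Category.id_comp q, ← biproduct.total, Preadditive.sum_comp,
      Preadditive.comp_sum]
    refine Finset.sum_congr rfl fun j _ => ?_
    conv_rhs => rw [Category.assoc, ← Category.id_comp (biproduct.ι _ _ ≫ q),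
      ← sum_projProjection_projInclusion, Preadditive.sum_comp, Preadditive.comp_sum,
      Preadditive.comp_sum]
    simp only [Category.assoc]
  obtain ⟨t, a, b, hab⟩ : ∃ (t : V) (a : M ⟶ projModule k t) (b : projModule k t ⟶ M),
      a ≫ b ≠ 0 := by
    by_contra! hcon
    refine h1 (hsum.symm.trans ?_)
    exact Finset.sum_eq_zero fun j _ => Finset.sum_eq_zero fun t _ => hcon t _ _
  obtain ⟨c, hc⟩ := hM.2 (a ≫ b)
  obtain ⟨d, hd⟩ := exists_smul_id_eq hV t (b ≫ a)
  dsimp only at hc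
  have hc0 : c ≠ 0 := fun h0 => hab (by rw [← hc, h0, zero_smul])
  -- Compare the two bracketings of a b a b.
  have hcd : c = d := by
    have h2 : (a ≫ b) ≫ a ≫ b = a ≫ (b ≫ a) ≫ b := by simp
    rw [← hd, ← hc] at h2
    have h3 : (c * c) • 𝟙 M = (c * d) • 𝟙 M := by
      have h4 : a ≫ (d • 𝟙 _) ≫ b = d • (a ≫ b) := by simp
      rw [h4, ← hc, smul_smul] at h2
      rw [mul_comm c d, ← h2]
      simp [smul_smul]
    exact mul_left_cancel₀ hc0 (hM.1 h3)
  refine ⟨t, ⟨⟨a, c⁻¹ • b, ?_, ?_⟩⟩⟩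
  · rw [Linear.comp_smul, ← hc, smul_smul, inv_mul_cancel₀ hc0, one_smul]
  · rw [Linear.smul_comp, ← hd, smul_smul, ← hcd, inv_mul_cancel₀ hc0, one_smul]

lemma IsSincere.of_iso {M M' : ModuleCat.{max u v w} (PathAlgebra k V)} (h : IsSincere M)
    (e : M ≅ M') : IsSincere M' := fun t => by
  obtain ⟨m, hm⟩ := h t
  refine ⟨e.hom m, fun h0 => hm ?_⟩
  have h1 : e.hom (PathAlgebra.e k t • m) = 0 := (map_smul e.hom.hom _ _).trans h0
  have h2 := congrArg e.inv h1
  simpa using h2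

lemma finite_regularModule (hV : Quiver.NoOrientedCycles V) [∀ x y : V, Finite (x ⟶ y)] :
    Module.Finite k (regularModule k V) := by
  have := finite_of_noOrientedCycles (k := k) hV
  let f : PathAlgebra k V →ₗ[k] regularModule k V :=
    { toFun := fun x => x
      map_add' := fun _ _ => rfl
      map_smul' := fun c x => Algebra.smul_def c x }
  exact Module.Finite.of_surjective f fun x => ⟨x, rfl⟩

lemma exists_isBongartzComplement (hV : Quiver.NoOrientedCycles V)
    [∀ x y : V, Finite (x ⟶ y)] (M : ModuleCat.{max u v w} (PathAlgebra k V))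
    [Module.Finite k M] (hM : IsExceptional k M) :
    ∃ B : ModuleCat.{max u v w} (PathAlgebra k V), IsBongartzComplement M B := by
  by_cases hP : Projective M
  · obtain ⟨s, hs⟩ := exists_iso_projModule hV M hM.2
    exact ⟨_, Or.inl ⟨hP, s, hs, ⟨Iso.refl _⟩⟩⟩
  · have : Module.Finite k (regularModule k V) := finite_regularModule hV
    have := finite_ext_one (k := k) (regularModule k V) (LinearEquiv.refl _ _) M
      (regularModule k V)
    obtain ⟨B, T, i, p, w, hξ, h⟩ :=
      exists_isMinimalUniversalExtension (k := k) (A := regularModule k V) hM.2.2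
    exact ⟨B, Or.inr ⟨hP, T, i, p, w, hξ, h⟩⟩

lemma isBongartzDatum_of_isBongartzComplement (hV : Quiver.NoOrientedCycles V)
    {M B : ModuleCat.{max u v w} (PathAlgebra k V)} (hM : IsExceptional k M)
    (hsincere : IsSincere M) (h : IsBongartzComplement M B) :
    IsBongartzDatum (regularModule k V) M B := by
  rcases h with ⟨hP, s, ⟨e⟩, ⟨e'⟩⟩ | ⟨hP, T, i, p, w, hξ, h⟩
  · exact ((isBongartzDatum_biproduct hV (IsSincere.of_iso hsincere e)).of_iso e').of_iso_left e
  -- A nonzero map from M to A would make M projective.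
  · have hMA : Subsingleton (M ⟶ regularModule k V) := by
      refine subsingleton_of_forall_eq 0 fun φ => ?_
      by_contra hφ
      exact hP (projective_of_hom_ne_zero hM.2.2 hφ)
    have : Projective (ShortComplex.mk i p w).X₁ :=
      inferInstanceAs (Projective (regularModule k V))
    exact h.isBongartzDatum hM hMA

end PathAlgebra

end BongartzComplement

theorem mainTheorem3 {k : Type u} [Field k] [IsAlgClosed k]
    {V : Type v} [Quiver.{w} V] [Fintype V] [∀ x y : V, Finite (x ⟶ y)]
    (hV : Quiver.NoOrientedCycles V)
    (M N : ModuleCat.{max u v w} (PathAlgebra k V))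
    (hMfin : IsFinDim M) (hNfin : IsFinDim N)
    (hM : IsExceptional k M) (hsincere : IsSincere M) :
    (∃ B : ModuleCat.{max u v w} (PathAlgebra k V), IsBongartzComplement M B) ∧
    ∀ B : ModuleCat.{max u v w} (PathAlgebra k V), IsBongartzComplement M B →
      ((CategoryTheory.Indecomposable N ∧ IsDirectSummand N B) ↔
        (IsExceptionalSequence k ![N, M] ∧
          ¬ CategoryTheory.Simple (⟨M, closureCat_mem ![N, M] 1⟩ :
            (closureCat ![N, M]).FullSubcategory))) := by
  let : Module k M := ModuleCat.moduleOfAlgebraModule M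
  let : Module k N := ModuleCat.moduleOfAlgebraModule N
  have : Module.Finite k M := hMfin
  have : Module.Finite k N := hNfin
  refine ⟨PathAlgebra.exists_isBongartzComplement hV M hM, fun B hB => ?_⟩
  have hD := PathAlgebra.isBongartzDatum_of_isBongartzComplement hV hM hsincere hB
  have := finite_hom (k := k) N N
  have := finite_hom (k := k) N M
  obtain ⟨n, q, hq⟩ := exists_epi_of_finite (k := k) (regularModule k V) (LinearEquiv.refl _ _) N
  refine summand_iff_of_isBongartzDatum hD hM (fun S hS hSM => ?_)
    (isIso_or_isNilpotent (k := k) N) q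
  have : Module.Projective (PathAlgebra k V) S :=
    ModuleCat.projective_of_module_projective S
  have := PathAlgebra.subsingleton_of_projective_of_sincere hV (S := S) hsincere fun f =>
    congrArg ModuleCat.Hom.hom (hSM.elim (ModuleCat.ofHom f) 0)
  exact ModuleCat.isZero_of_subsingleton S
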